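/- For integers $n,s\ge 1$ let $\mu_{n,s}$ be the distribution of the random state $\rho=\operatorname{tr}_{\mathbf C^s}|\psi\rangle\langle\psi|$ on $\mathbf C^n$, where $\psi$ is uniformly distributed on the unit sphere of $\mathbf C^n\otimes\mathbf C^s$ and $\operatorname{tr}_{\mathbf C^s}$ is the partial trace over $\mathbf C^s$. For $n=d^2$ identify $\mathbf C^{n}$ with $\mathbf C^d\otimes\mathbf C^d$; the realignment $A^R$ of a matrix $A=(A_{ij,kl})$ on $\mathbf C^d\otimes\mathbf C^d$ (row index $(i,j)$, column index $(k,l)$) is the $d^2\times d^2$ matrix whose entry in row $(i,k)$ and column $(j,l)$ is $A_{ij,kl}$, and $\|\cdot\|_1$ denotes the trace norm (the sum of the singular values). There exist absolute constants $c,C,c_0,C_0>0$ such that, for all integers $d,s\ge 1$ and for a random state $\rho$ on $\mathbf C^d\otimes\mathbf C^d$ with distribution $\mu_{d^2,s}$, the following holds. 1. If $s\le c_0d^2$, then $\mathbf P(\|\rho^R\|_1>1)\ge 1-C\exp(-c\,d^{1/4})$. 2. If $s\ge C_0d^2$, then $\mathbf P(\|\rho^R\|_1\le 1)\ge 1-C\exp(-c\,d^{1/4})$.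 -/

import Mathlib

open MeasureTheory
open scoped Matrix

noncomputable section

/-- Matrices carry the product (equivalently, Borel) σ-algebra of their entries. -/
instance instMeasurableSpaceMatrixComplex (m n : Type*) : MeasurableSpace (Matrix m n ℂ) :=
  inferInstanceAs (MeasurableSpace (m → n → ℂ))

/-- The uniform probability measure on the unit sphere of a finite-dimensional Euclidean space:
the surface measure induced by Lebesgue measure, normalized to total mass one. It is applied below
to `EuclideanSpace ℂ ι`, viewed as a real Euclidean space. -/
def uniformSphere (E : Type*) [NormedAddCommGroup E] [InnerProductSpace ℝ E]
    [FiniteDimensional ℝ E] [MeasurableSpace E] [BorelSpace E] :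
    Measure (Metric.sphere (0 : E) 1) :=
  ((volume : Measure E).toSphere Set.univ)⁻¹ • (volume : Measure E).toSphere

theorem isProbabilityMeasure_uniformSphere (E : Type*) [NormedAddCommGroup E]
    [InnerProductSpace ℝ E] [FiniteDimensional ℝ E] [MeasurableSpace E] [BorelSpace E]
    [Nontrivial E] : IsProbabilityMeasure (uniformSphere E) := by
  have h : (volume : Measure E).toSphere ≠ 0 :=
    (volume : Measure E).toSphere_ne_zero
  constructor
  rw [uniformSphere, Measure.smul_apply, smul_eq_mul]
  exact ENNReal.inv_mul_cancel (Measure.measure_univ_ne_zero.2 h) (measure_ne_top _ _)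

/-- The rank-one matrix `|ψ⟩⟨ψ|`, with entries `ψ a * conj (ψ b)`. -/
def ketbra {ι : Type*} (ψ : EuclideanSpace ℂ ι) : Matrix ι ι ℂ :=
  Matrix.of fun a b => ψ a * star (ψ b)

/-- The partial trace over the second factor of `ℂⁿ ⊗ ℂˢ`. -/
def partialTraceRight {n s : Type*} [Fintype s] (A : Matrix (n × s) (n × s) ℂ) :
    Matrix n n ℂ :=
  Matrix.of fun a b => ∑ k, A (a, k) (b, k)

theorem measurable_partialTraceRight_ketbra (n s : Type*) [Fintype n] [Fintype s] :
    Measurable fun ψ : Metric.sphere (0 : EuclideanSpace ℂ (n × s)) 1 =>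
      partialTraceRight (ketbra (ψ : EuclideanSpace ℂ (n × s))) := by
  refine measurable_pi_iff.2 fun a => measurable_pi_iff.2 fun b => ?_
  refine Continuous.measurable ?_
  simp only [partialTraceRight, ketbra, Matrix.of_apply]
  fun_prop

/-- The distribution of the induced random state `tr_{ℂˢ} |ψ⟩⟨ψ|` on `ℂⁿ`, where `ψ` is uniform on
the unit sphere of `ℂⁿ ⊗ ℂˢ`. Here `n` and `s` are the finite types that index the canonical bases
of the two factors. -/
def inducedState (n s : Type*) [Fintype n] [Fintype s] : Measure (Matrix n n ℂ) :=
  (uniformSphere (EuclideanSpace ℂ (n × s))).map fun ψ => partialTraceRight (ketbra ψ.1)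

theorem isProbabilityMeasure_inducedState (n s : Type*) [Fintype n] [Fintype s]
    [Nonempty n] [Nonempty s] : IsProbabilityMeasure (inducedState n s) := by
  have := isProbabilityMeasure_uniformSphere (EuclideanSpace ℂ (n × s))
  exact Measure.isProbabilityMeasure_map (measurable_partialTraceRight_ketbra n s).aemeasurable

/-- The realignment `A^R` of a matrix `A` on `ℂ^{m₁} ⊗ ℂ^{m₂}`: the entry of `A^R` in row `(i, k)`
and column `(j, l)` is the entry of `A` in row `(i, j)` and column `(k, l)`. -/
def realign {m₁ m₂ : Type*} (A : Matrix (m₁ × m₂) (m₁ × m₂) ℂ) :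
    Matrix (m₁ × m₁) (m₂ × m₂) ℂ :=
  Matrix.of fun p q => A (p.1, q.1) (p.2, q.2)

/-- The trace norm `‖A‖₁ = tr ((Aᴴ A)^{1/2})`: the sum of the singular values of `A`, which are the
square roots of the eigenvalues of `Aᴴ A` counted with multiplicity. -/
def traceNorm {m n : Type*} [Fintype m] [Fintype n] [DecidableEq n] (A : Matrix m n ℂ) : ℝ :=
  ∑ i, √((Matrix.isHermitian_conjTranspose_mul_self A).eigenvalues i)

end

/-! A uniform unit vector is a normalised Gaussian vector, so `ρ = G Gᴴ / tr (G Gᴴ)` with `G` a `d²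
× s` matrix of independent complex Gaussian entries of mean square 1. Write `R = G Gᴴ`, of mean `s ·
1`. An event on states becomes a cone in Gaussian space (`uniformSphere_le_gaussianOn`), where
quadratic forms have explicit Laplace transforms. Suprema of bilinear forms are controlled by
1/4-nets and union bounds (`norm_bilinear_le_of_net`).

Large `s`: a net on the unit ball of `ℂ^{d²}` shows that `R` is within `s / 5` of `s · 1` in
operator norm, so `ρ - 1/d²` has Hilbert–Schmidt norm at most `1/(2d)`. Realignment preserves this
norm and sends `1/d²` to a rank-one matrix of trace norm `1/d`. Hence `‖ρ^R‖₁ ≤ d · 1/(2d) + 1/d ≤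
1` for `d ≥ 2` (`traceNorm_realign_le_one`).

Small `s`: pair `ρ` with `C = ρ - 1/d²`. Since `ρ` has rank at most `s`, `tr (ρ C) ≥ 1/s - 1/d² ≥
1/(2s)`; if moreover `‖C^R‖_op ≤ 1/(4s)`, duality gives `‖ρ^R‖₁ ≥ 2` (`one_lt_traceNorm_realign`).
Now `‖C^R‖_op` is the supremum of `|tr (C (X ⊗ Y))|` over Hilbert–Schmidt unit balls, so it suffices
to bound the centred form `tr (R (X ⊗ Y)) - s tr X tr Y` by a small multiple of `d²` there.

A plain net fails: the nets cost `exp (9 d²)`, while when `X` and `Y` have operator norm 1 the tail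
at level `d²/320` is too heavy. The eigenvalues are therefore split at a small constant `δ`
(`norm_kronForm_le_of_split`). If one factor has operator norm at most `δ`, the Chernoff parameter
may be of order `1/δ` and beats the nets. If both factors have only eigenvalues above `δ`, their
trace norms are at most `1/δ`, and the form reduces to `‖Gᴴ (u ⊗ v)‖²` on product vectors, whose
nets cost only `exp (9 d)`. -/

/-- The Gaussian probability measure with density proportional to `exp (-‖x‖ ^ 2)`. -/
noncomputable def gaussianOn (E : Type*) [NormedAddCommGroup E] [InnerProductSpace ℝ E]
    [FiniteDimensional ℝ E] [MeasurableSpace E] [BorelSpace E] : Measure E :=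
  volume.withDensity fun x =>
    ENNReal.ofReal ((√Real.pi ^ Module.finrank ℝ E)⁻¹ * Real.exp (-‖x‖ ^ 2))

/-! ### Gaussian quadratic forms and the passage from the sphere to Gaussian space. -/

section Gaussian

variable {E : Type*} [NormedAddCommGroup E] [InnerProductSpace ℝ E]
    [FiniteDimensional ℝ E] [MeasurableSpace E] [BorelSpace E] {κ : Type*} [Fintype κ]

theorem lintegral_exp_diagonal (c : κ → ℝ) (hc : ∀ i, c i < 1) :
    ∫⁻ y : κ → ℝ, ENNReal.ofReal (∏ i, Real.exp (-(1 - c i) * y i ^ 2)) =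
      ENNReal.ofReal (∏ i, √(Real.pi / (1 - c i))) := by
  rw [← ofReal_integral_eq_lintegral_ofReal]
  · rw [integral_fintype_prod_volume_eq_prod (fun i y => Real.exp (-(1 - c i) * y ^ 2))]
    simp_rw [integral_gaussian]
  · exact Integrable.fintype_prod (f := fun i y => Real.exp (-(1 - c i) * y ^ 2))
      fun i => integrable_exp_neg_mul_sq (by linarith [hc i])
  · exact Filter.Eventually.of_forall fun y => by positivity

theorem lintegral_exp_gaussianOn (b : OrthonormalBasis κ ℝ E) (c : κ → ℝ) (hc : ∀ i, c i < 1) :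
    ∫⁻ x, ENNReal.ofReal (Real.exp (∑ i, c i * b.repr x i ^ 2)) ∂gaussianOn E =
      ENNReal.ofReal (∏ i, (√(1 - c i))⁻¹) := by
  have hcard : Module.finrank ℝ E = Fintype.card κ := Module.finrank_eq_card_basis b.toBasis
  have key : ∀ x : E, ENNReal.ofReal ((√Real.pi ^ Module.finrank ℝ E)⁻¹ * Real.exp (-‖x‖ ^ 2)) *
      ENNReal.ofReal (Real.exp (∑ i, c i * b.repr x i ^ 2)) =
      ENNReal.ofReal ((√Real.pi ^ Module.finrank ℝ E)⁻¹) *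
        ENNReal.ofReal (∏ i, Real.exp (-(1 - c i) * (b.repr x i) ^ 2)) := by
    intro x
    rw [← ENNReal.ofReal_mul (by positivity), ← ENNReal.ofReal_mul (by positivity), mul_assoc,
      ← Real.exp_add, ← Real.exp_sum, ← b.repr.norm_map x, EuclideanSpace.real_norm_sq_eq,
      ← Finset.sum_neg_distrib, ← Finset.sum_add_distrib]
    congr 3
    exact Finset.sum_congr rfl fun i _ => by ring
  rw [gaussianOn, lintegral_withDensity_eq_lintegral_mul _ (by fun_prop) (by fun_prop)]
  simp only [Pi.mul_apply, key]
  rw [lintegral_const_mul _ (by fun_prop)]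
  have h1 := (b.measurePreserving_repr).lintegral_comp
    (f := fun y : EuclideanSpace ℝ κ =>
      ENNReal.ofReal (∏ i, Real.exp (-(1 - c i) * (y i) ^ 2))) (by fun_prop)
  have h2 := (PiLp.volume_preserving_ofLp κ).lintegral_comp
    (f := fun y : κ → ℝ =>
      ENNReal.ofReal (∏ i, Real.exp (-(1 - c i) * (y i) ^ 2))) (by fun_prop)
  rw [h1, h2, lintegral_exp_diagonal c hc, ← ENNReal.ofReal_mul (by positivity), hcard]
  congr 1
  simp_rw [Real.sqrt_div Real.pi_pos.le, div_eq_mul_inv, Finset.prod_mul_distrib]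
  rw [Finset.prod_const, Finset.card_univ, ← mul_assoc, inv_mul_cancel₀ (by positivity), one_mul]

instance isProbabilityMeasure_gaussianOn : IsProbabilityMeasure (gaussianOn E) := by
  constructor
  have := lintegral_exp_gaussianOn (stdOrthonormalBasis ℝ E) (fun _ => 0) (by simp)
  simpa using this

/-- Equivalent to `1 ≤ (1 - c) exp (c + c²)`. For `c ≥ 0` the quadratic Taylor bound for `exp` is
needed; for `c ≤ 0` the linear one suffices. -/
theorem inv_sqrt_one_sub_le_exp {c : ℝ} (hc : |c| ≤ 1 / 2) :
    (√(1 - c))⁻¹ ≤ Real.exp ((c + c ^ 2) / 2) := by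
  obtain ⟨h1, h2⟩ := abs_le.1 hc
  have hpos : 0 < 1 - c := by linarith
  have key : 1 ≤ (1 - c) * Real.exp (c + c ^ 2) := by
    rcases le_total 0 c with h0 | h0
    · have := Real.quadratic_le_exp_of_nonneg (x := c + c ^ 2) (by positivity)
      have h3 : (1 - c) * (1 + (c + c ^ 2) + (c + c ^ 2) ^ 2 / 2) ≤
          (1 - c) * Real.exp (c + c ^ 2) := by gcongr
      have h4 : 0 ≤ 1 - c - c ^ 2 - c ^ 3 := by nlinarith [mul_nonneg h0 h0]
      nlinarith [mul_nonneg (mul_nonneg h0 h0) h4]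
    · have := Real.add_one_le_exp (c + c ^ 2)
      have h3 : (1 - c) * (c + c ^ 2 + 1) ≤ (1 - c) * Real.exp (c + c ^ 2) := by gcongr
      have h4 : 0 ≤ -(c * c ^ 2) := by nlinarith [sq_nonneg c]
      nlinarith
  rw [inv_le_iff_one_le_mul₀ (by positivity), mul_comm]
  have h5 : Real.exp ((c + c ^ 2) / 2) = √(Real.exp (c + c ^ 2)) := Real.exp_half _
  rw [h5, ← Real.sqrt_mul hpos.le]
  exact Real.one_le_sqrt.2 key

/-- Exponential Markov inequality. Each real coordinate has variance `1/2`, so `(∑ c i) / 2` is the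
mean of the form. -/
theorem gaussianOn_quadratic_tail (b : OrthonormalBasis κ ℝ E) (c : κ → ℝ)
    (hc : ∀ i, |c i| ≤ 1 / 2) (t : ℝ) :
    gaussianOn E {x | t + (∑ i, c i) / 2 ≤ ∑ i, c i * b.repr x i ^ 2} ≤
      ENNReal.ofReal (Real.exp (-t + (∑ i, c i ^ 2) / 2)) := by
  have hsub : {x : E | t + (∑ i, c i) / 2 ≤ ∑ i, c i * b.repr x i ^ 2} ⊆
      {x | ENNReal.ofReal (Real.exp (t + (∑ i, c i) / 2)) ≤
        ENNReal.ofReal (Real.exp (∑ i, c i * b.repr x i ^ 2))} := fun x hx =>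
    ENNReal.ofReal_le_ofReal (Real.exp_le_exp.2 hx)
  refine (measure_mono hsub).trans ?_
  refine (meas_ge_le_lintegral_div (by fun_prop) (by simp [Real.exp_pos]) (by simp)).trans ?_
  rw [lintegral_exp_gaussianOn b c fun i => by linarith [(abs_le.1 (hc i)).2],
    ← ENNReal.ofReal_div_of_pos (Real.exp_pos _)]
  refine ENNReal.ofReal_le_ofReal ?_
  rw [div_le_iff₀ (Real.exp_pos _), ← Real.exp_add]
  calc ∏ i, (√(1 - c i))⁻¹ ≤ ∏ i, Real.exp ((c i + c i ^ 2) / 2) :=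
        Finset.prod_le_prod (fun i _ => by positivity) fun i _ => inv_sqrt_one_sub_le_exp (hc i)
    _ = _ := by
        rw [← Real.exp_sum, ← Finset.sum_div, Finset.sum_add_distrib]
        congr 1
        ring

/-- Polar coordinates: the density is radial, so the Gaussian mass of the cone over `S` factors into
surface measure times a radial integral independent of `S`. -/
theorem toSphere_mul_lintegral_eq_gaussianOn [Nontrivial E] {S : Set (Metric.sphere (0 : E) 1)}
    (hS : MeasurableSet S) :
    (volume : Measure E).toSphere S * ∫⁻ r, ENNReal.ofReal
        ((√Real.pi ^ Module.finrank ℝ E)⁻¹ * Real.exp (-(r : ℝ) ^ 2))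
        ∂(Measure.volumeIoiPow (Module.finrank ℝ E - 1)) =
      gaussianOn E ((fun p : Metric.sphere (0 : E) 1 × Set.Ioi (0 : ℝ) =>
        (p.2 : ℝ) • (p.1 : E)) '' (S ×ˢ Set.univ)) := by
  set q : E → ENNReal := fun x =>
    ENNReal.ofReal ((√Real.pi ^ Module.finrank ℝ E)⁻¹ * Real.exp (-‖x‖ ^ 2)) with hq
  set C : Set E := (fun p : Metric.sphere (0 : E) 1 × Set.Ioi (0 : ℝ) =>
        (p.2 : ℝ) • (p.1 : E)) '' (S ×ˢ Set.univ) with hC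
  have hCimg : C = (fun x : ({0}ᶜ : Set E) => (x : E)) ''
      ((homeomorphUnitSphereProd E) ⁻¹' (S ×ˢ Set.univ)) := by
    rw [← Homeomorph.image_symm, Set.image_image, hC]
    rfl
  have hmeas : MeasurableSet ((homeomorphUnitSphereProd E) ⁻¹' (S ×ˢ Set.univ)) :=
    (homeomorphUnitSphereProd E).measurable (hS.prod MeasurableSet.univ)
  have hCm : MeasurableSet C := by
    rw [hCimg]
    exact (MeasurableEmbedding.subtype_coe (measurableSet_singleton _).compl).measurableSet_image.2
      hmeas
  have hqr : ∀ x : ({0}ᶜ : Set E), q x = ENNReal.ofReal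
        ((√Real.pi ^ Module.finrank ℝ E)⁻¹ *
          Real.exp (-((homeomorphUnitSphereProd E x).2 : ℝ) ^ 2)) := fun x => by simp [hq]
  rw [gaussianOn, withDensity_apply _ hCm, hCimg,
    ← setLIntegral_subtype (measurableSet_singleton _).compl]
  rw [setLIntegral_congr_fun hmeas fun x _ => hqr x,
    (volume : Measure E).measurePreserving_homeomorphUnitSphereProd.setLIntegral_comp_preimage
      (f := fun p => ENNReal.ofReal
        ((√Real.pi ^ Module.finrank ℝ E)⁻¹ * Real.exp (-(p.2 : ℝ) ^ 2)))
      (hS.prod MeasurableSet.univ) (by fun_prop), ← Measure.prod_restrict, Measure.restrict_univ,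
    lintegral_prod _ (by fun_prop)]
  simp [mul_comm]

/-- Taking `S` to be the whole sphere identifies the radial integral as the normalising constant, so
the uniform measure of `S` is the Gaussian measure of its cone, which lies in `T`. -/
theorem uniformSphere_le_gaussianOn [Nontrivial E] {S : Set (Metric.sphere (0 : E) 1)}
    (hS : MeasurableSet S) {T : Set E} (hT : ∀ ψ ∈ S, ∀ r : ℝ, 0 < r → r • (ψ : E) ∈ T) :
    uniformSphere E S ≤ gaussianOn E T := by
  have h1 := toSphere_mul_lintegral_eq_gaussianOn hS
  have h2 := toSphere_mul_lintegral_eq_gaussianOn (E := E) MeasurableSet.univ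
  set I := ∫⁻ r, ENNReal.ofReal
        ((√Real.pi ^ Module.finrank ℝ E)⁻¹ * Real.exp (-(r : ℝ) ^ 2))
        ∂(Measure.volumeIoiPow (Module.finrank ℝ E - 1))
  have h0 : (volume : Measure E).toSphere Set.univ ≠ 0 :=
    Measure.measure_univ_ne_zero.2 (volume : Measure E).toSphere_ne_zero
  have htop : (volume : Measure E).toSphere Set.univ ≠ ⊤ := measure_ne_top _ _
  have h3 : (volume : Measure E).toSphere Set.univ * I = 1 := by
    have hsing : gaussianOn E {0} = 0 :=
      withDensity_absolutelyContinuous _ _ (measure_singleton _)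
    have himg : ((fun p : Metric.sphere (0 : E) 1 × Set.Ioi (0 : ℝ) =>
        (p.2 : ℝ) • (p.1 : E)) '' (Set.univ ×ˢ Set.univ)) = {0}ᶜ := by
      ext x
      constructor
      · rintro ⟨⟨σ, r⟩, -, rfl⟩
        exact smul_ne_zero (ne_of_gt r.2) (by
          rw [← norm_ne_zero_iff, mem_sphere_zero_iff_norm.1 σ.2]; exact one_ne_zero)
      · intro hx
        have hx' : 0 < ‖x‖ := norm_pos_iff.2 hx
        refine ⟨(⟨‖x‖⁻¹ • x, by simp [norm_smul, hx'.ne']⟩, ⟨‖x‖, hx'⟩), by simp, ?_⟩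
        simp [smul_smul, hx'.ne']
    rw [h2, himg, prob_compl_eq_one_iff (measurableSet_singleton _), hsing]
  have h4 : ((volume : Measure E).toSphere Set.univ)⁻¹ = I :=
    (ENNReal.eq_inv_of_mul_eq_one_left (by rw [mul_comm]; exact h3)).symm
  rw [uniformSphere, Measure.smul_apply, smul_eq_mul, h4, mul_comm, h1]
  refine measure_mono ?_
  rintro _ ⟨⟨σ, r⟩, hσ, rfl⟩
  exact hT σ hσ.1 r r.2

end Gaussian

/-! ### Nets of unit balls and suprema of bilinear maps. -/

section Nets

-- Volume comparison: disjoint balls of radius `1/8` inside a ball of radius `9/8`.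
open Metric in
theorem card_le_of_quarter_separated {V : Type*} [NormedAddCommGroup V] [NormedSpace ℝ V]
    [FiniteDimensional ℝ V] (s : Finset V) (hs : ∀ c ∈ s, ‖c‖ ≤ 1)
    (h : ∀ c ∈ s, ∀ d ∈ s, c ≠ d → 1 / 4 ≤ ‖c - d‖) : s.card ≤ 9 ^ Module.finrank ℝ V := by
  borelize V
  let μ : Measure V := Measure.addHaar
  have hdisj : Set.Pairwise (s : Set V) (Function.onFun Disjoint fun c => ball (c : V) (1 / 8)) := by
    rintro c hc d hd hcd
    apply ball_disjoint_ball
    rw [dist_eq_norm]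
    linarith [h c hc d hd hcd]
  have hsub : (⋃ c ∈ s, ball (c : V) (1 / 8)) ⊆ ball (0 : V) (9 / 8) := by
    refine Set.iUnion₂_subset fun x hx => ball_subset_ball' ?_
    rw [dist_zero_right]
    linarith [hs x hx]
  have h1 := measure_mono (μ := μ) hsub
  rw [measure_biUnion_finset hdisj fun c _ => measurableSet_ball,
    μ.addHaar_ball_of_pos _ (by norm_num)] at h1
  simp only [μ.addHaar_ball_of_pos _ (show (0 : ℝ) < 1 / 8 by norm_num), Finset.sum_const,
    nsmul_eq_mul, ← mul_assoc] at h1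
  have h2 := ENNReal.toReal_le_of_le_ofReal (by positivity)
    ((ENNReal.mul_le_mul_iff_left (measure_ball_pos _ _ zero_lt_one).ne' measure_ball_lt_top.ne).1 h1)
  have h3 : (s.card : ℝ) ≤ 9 ^ Module.finrank ℝ V := by
    simpa [div_eq_mul_inv, mul_pow] using h2
  exact_mod_cast h3

/-- A separated set of greatest cardinality is a net; the volume bound makes the greatest
cardinality exist. -/
theorem exists_net_unitBall (V : Type*) [NormedAddCommGroup V] [NormedSpace ℝ V]
    [FiniteDimensional ℝ V] : ∃ N : Finset V, (∀ c ∈ N, ‖c‖ ≤ 1) ∧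
      N.card ≤ 9 ^ Module.finrank ℝ V ∧ ∀ x, ‖x‖ ≤ 1 → ∃ c ∈ N, ‖x - c‖ ≤ 1 / 4 := by
  classical
  let P : ℕ → Prop := fun k => ∃ N : Finset V, (∀ c ∈ N, ‖c‖ ≤ 1) ∧
    (∀ c ∈ N, ∀ d ∈ N, c ≠ d → 1 / 4 ≤ ‖c - d‖) ∧ N.card = k
  have hP0 : P 0 := ⟨∅, by simp, by simp, rfl⟩
  obtain ⟨N, h1, h2, h3⟩ : P (Nat.findGreatest P (9 ^ Module.finrank ℝ V)) :=
    Nat.findGreatest_spec (Nat.zero_le _) hP0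
  refine ⟨N, h1, card_le_of_quarter_separated N h1 h2, fun x hx => ?_⟩
  by_contra! hfar
  have hxN : x ∉ N := fun hxN => by
    have := hfar x hxN
    norm_num at this
  have hb : ∀ c ∈ insert x N, ‖c‖ ≤ 1 := fun c hc => by
    rcases Finset.mem_insert.1 hc with rfl | hc
    exacts [hx, h1 c hc]
  have hsep : ∀ c ∈ insert x N, ∀ d ∈ insert x N, c ≠ d → 1 / 4 ≤ ‖c - d‖ := by
    intro c hc d hd hcd
    rcases Finset.mem_insert.1 hc with rfl | hc' <;> rcases Finset.mem_insert.1 hd with rfl | hd'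
    · exact absurd rfl hcd
    · exact (hfar d hd').le
    · rw [norm_sub_rev]
      exact (hfar c hc').le
    · exact h2 c hc' d hd' hcd
  have hcard := card_le_of_quarter_separated _ hb hsep
  have h4 := Nat.le_findGreatest (P := P) hcard ⟨_, hb, hsep, rfl⟩
  rw [Finset.card_insert_of_notMem hxN] at h4
  omega

/-- Replacing each argument by a net point costs `‖T‖ / 4`, so `‖T‖ ≤ t + ‖T‖ / 2`, which is
absorbed. -/
theorem norm_bilinear_le_of_net {V W F : Type*} [NormedAddCommGroup V] [NormedSpace ℝ V]
    [FiniteDimensional ℝ V] [NormedAddCommGroup W] [NormedSpace ℝ W] [FiniteDimensional ℝ W]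
    [NormedAddCommGroup F] [NormedSpace ℝ F] {N : Finset V} {N' : Finset W}
    (hN : ∀ c ∈ N, ‖c‖ ≤ 1) (hN' : ∀ x, ‖x‖ ≤ 1 → ∃ c ∈ N, ‖x - c‖ ≤ 1 / 4)
    (hM : ∀ x, ‖x‖ ≤ 1 → ∃ c ∈ N', ‖x - c‖ ≤ 1 / 4)
    (B : V →ₗ[ℝ] W →ₗ[ℝ] F) {t : ℝ} (hB : ∀ c ∈ N, ∀ d ∈ N', ‖B c d‖ ≤ t) {x : V} {y : W}
    (hx : ‖x‖ ≤ 1) (hy : ‖y‖ ≤ 1) : ‖B x y‖ ≤ 2 * t := by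
  let T : V →L[ℝ] W →L[ℝ] F :=
    LinearMap.toContinuousLinearMap (LinearMap.toContinuousLinearMap.toLinearMap ∘ₗ B)
  have hT : ∀ u v, T u v = B u v := fun u v => rfl
  have ht : 0 ≤ t := by
    obtain ⟨c, hc, -⟩ := hN' 0 (by simp)
    obtain ⟨d, hd, -⟩ := hM 0 (by simp)
    exact (norm_nonneg _).trans (hB c hc d hd)
  have hball : ∀ u v, ‖u‖ ≤ 1 → ‖v‖ ≤ 1 → ‖T u v‖ ≤ t + ‖T‖ / 2 := by
    intro u v hu hv
    obtain ⟨c, hc, huc⟩ := hN' u hu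
    obtain ⟨d, hd, hvd⟩ := hM v hv
    have h1 : T u v = T c d + T (u - c) v + T c (v - d) := by
      simp only [map_sub, sub_apply]
      abel
    have h2 : ‖T (u - c) v‖ ≤ ‖T‖ * (1 / 4) * 1 :=
      (T.le_opNorm₂ _ _).trans (by gcongr)
    have h3 : ‖T c (v - d)‖ ≤ ‖T‖ * 1 * (1 / 4) :=
      (T.le_opNorm₂ _ _).trans (by gcongr; exact hN c hc)
    rw [h1]
    have := norm_add₃_le (a := T c d) (b := T (u - c) v) (c := T c (v - d))
    have h4 : ‖T c d‖ ≤ t := hB c hc d hd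
    linarith
  have hnorm : ‖T‖ ≤ t + ‖T‖ / 2 := by
    have h0 : 0 ≤ t + ‖T‖ / 2 := by positivity
    refine T.opNorm_le_of_unit_norm h0 fun u hu => ?_
    exact (T u).opNorm_le_of_unit_norm h0 fun v hv => hball u v hu.le hv.le
  have := hball x y hx hy
  rw [hT] at this
  linarith

/-- A finite net of the unit ball `{x | ‖J x‖ ≤ 1}` of the norm pulled back along `J`. -/
def IsUnitBallNet {V F : Type*} [AddCommGroup V] [Module ℝ V] [NormedAddCommGroup F]
    [NormedSpace ℝ F] (J : V →ₗ[ℝ] F) (N : Finset V) : Prop :=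
  (∀ c ∈ N, ‖J c‖ ≤ 1) ∧ N.card ≤ 9 ^ Module.finrank ℝ V ∧
    ∀ x, ‖J x‖ ≤ 1 → ∃ c ∈ N, ‖J (x - c)‖ ≤ 1 / 4

/-- Working through `J` allows several norms on the same space of matrices, in particular a maximum
of two norms, without fixing a norm on it. -/
theorem exists_isUnitBallNet {V F : Type*} [AddCommGroup V] [Module ℝ V] [FiniteDimensional ℝ V]
    [NormedAddCommGroup F] [NormedSpace ℝ F] (J : V →ₗ[ℝ] F) (hJ : Function.Injective J) :
    ∃ N : Finset V, IsUnitBallNet J N := by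
  classical
  let e := LinearEquiv.ofInjective J hJ
  have he : ∀ x, ‖e x‖ = ‖J x‖ := fun x => rfl
  obtain ⟨N, h1, h2, h3⟩ := exists_net_unitBall (LinearMap.range J)
  refine ⟨N.image e.symm, ?_, ?_, ?_⟩
  · intro c hc
    obtain ⟨y, hy, rfl⟩ := Finset.mem_image.1 hc
    rw [← he, e.apply_symm_apply]
    exact h1 y hy
  · rw [e.finrank_eq]
    exact Finset.card_image_le.trans h2
  · intro x hx
    obtain ⟨c, hc, hxc⟩ := h3 (e x) (by rwa [he])
    refine ⟨e.symm c, Finset.mem_image_of_mem _ hc, ?_⟩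
    rw [← he, map_sub, e.apply_symm_apply]
    exact hxc

theorem IsUnitBallNet.norm_bilinear_le {V W F F' F'' : Type*} [AddCommGroup V] [Module ℝ V]
    [FiniteDimensional ℝ V] [AddCommGroup W] [Module ℝ W] [FiniteDimensional ℝ W]
    [NormedAddCommGroup F] [NormedSpace ℝ F] [NormedAddCommGroup F'] [NormedSpace ℝ F']
    [NormedAddCommGroup F''] [NormedSpace ℝ F'']
    {J : V →ₗ[ℝ] F} (hJ : Function.Injective J) {J' : W →ₗ[ℝ] F'} (hJ' : Function.Injective J')
    {N : Finset V} {N' : Finset W} (hN : IsUnitBallNet J N) (hN' : IsUnitBallNet J' N')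
    (B : V →ₗ[ℝ] W →ₗ[ℝ] F'') {t : ℝ} (hB : ∀ c ∈ N, ∀ d ∈ N', ‖B c d‖ ≤ t) {x : V} {y : W}
    (hx : ‖J x‖ ≤ 1) (hy : ‖J' y‖ ≤ 1) : ‖B x y‖ ≤ 2 * t := by
  classical
  let e := LinearEquiv.ofInjective J hJ
  let e' := LinearEquiv.ofInjective J' hJ'
  have he : ∀ x, ‖e x‖ = ‖J x‖ := fun x => rfl
  have he' : ∀ x, ‖e' x‖ = ‖J' x‖ := fun x => rfl
  have := norm_bilinear_le_of_net (N := N.image e) (N' := N'.image e')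
    (fun c hc => by
      obtain ⟨y, hy, rfl⟩ := Finset.mem_image.1 hc
      exact hN.1 y hy)
    (fun v hv => by
      obtain ⟨c, hc, h⟩ := hN.2.2 (e.symm v) (by rw [← he, e.apply_symm_apply]; exact hv)
      exact ⟨e c, Finset.mem_image_of_mem _ hc, by
        rw [← he, map_sub, e.apply_symm_apply] at h; exact h⟩)
    (fun v hv => by
      obtain ⟨c, hc, h⟩ := hN'.2.2 (e'.symm v) (by rw [← he', e'.apply_symm_apply]; exact hv)
      exact ⟨e' c, Finset.mem_image_of_mem _ hc, by
        rw [← he', map_sub, e'.apply_symm_apply] at h; exact h⟩)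
    (B.compl₁₂ e.symm.toLinearMap e'.symm.toLinearMap) (t := t)
    (fun c hc d hd => by
      obtain ⟨c', hc', rfl⟩ := Finset.mem_image.1 hc
      obtain ⟨d', hd', rfl⟩ := Finset.mem_image.1 hd
      simpa using hB c' hc' d' hd')
    (x := e x) (y := e' y) (by rwa [he]) (by rwa [he'])
  simpa using this

end Nets

/-! ### Concentration of `tr (G Gᴴ M)`. -/

section Tails

open scoped Kronecker

/-- The coefficient matrix of a vector of `ℂⁿ ⊗ ℂˢ`. -/
def coeffMatrix {n σ : Type*} (z : EuclideanSpace ℂ (n × σ)) : Matrix n σ ℂ :=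
  Matrix.of fun a k => z (a, k)

theorem partialTraceRight_ketbra {n σ : Type*} [Fintype σ] (z : EuclideanSpace ℂ (n × σ)) :
    partialTraceRight (ketbra z) = coeffMatrix z * (coeffMatrix z)ᴴ := by
  ext a b
  simp [partialTraceRight, ketbra, Matrix.mul_apply, coeffMatrix]

variable {n σ : Type*} [Fintype n] [Fintype σ]

theorem trace_mul_conjTranspose_mul_diagonal [DecidableEq n] (A : Matrix n σ ℂ) (w : n → ℝ) :
    (A * Aᴴ * Matrix.diagonal fun a => (w a : ℂ)).trace =
      ((∑ p : n × σ, w p.1 * ‖A p.1 p.2‖ ^ 2 : ℝ) : ℂ) := by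
  simp only [Matrix.trace, Matrix.diag_apply, Matrix.mul_diagonal]
  rw [Fintype.sum_prod_type]
  push_cast
  refine Finset.sum_congr rfl fun a _ => ?_
  rw [Matrix.mul_apply, Finset.sum_mul]
  refine Finset.sum_congr rfl fun k _ => ?_
  rw [Matrix.conjTranspose_apply, Complex.star_def, Complex.mul_conj, Complex.normSq_eq_norm_sq]
  push_cast
  ring

theorem trace_mul_conjTranspose_eq_norm_sq (z : EuclideanSpace ℂ (n × σ)) :
    (coeffMatrix z * (coeffMatrix z)ᴴ).trace = ((‖z‖ ^ 2 : ℝ) : ℂ) := by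
  classical
  have h := trace_mul_conjTranspose_mul_diagonal (coeffMatrix z) fun _ => 1
  rw [EuclideanSpace.norm_sq_eq]
  simpa [coeffMatrix] using h

/-- The isometry of `ℂⁿ ⊗ ℂˢ` induced by the adjoint of a unitary matrix on `ℂⁿ`. -/
noncomputable def unitaryRotation [DecidableEq n] (W : Matrix n n ℂ)
    (hW : W ∈ Matrix.unitaryGroup n ℂ) :
    EuclideanSpace ℂ (n × σ) ≃ₗᵢ[ℝ] EuclideanSpace ℂ (n × σ) :=
  LinearIsometry.toLinearIsometryEquiv
    { toFun := fun z => WithLp.toLp 2 fun p => (Wᴴ * coeffMatrix z) p.1 p.2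
      map_add' := fun x y => by
        ext p
        simp [coeffMatrix, Matrix.mul_apply, mul_add, Finset.sum_add_distrib]
      map_smul' := fun r x => by
        ext p
        simp only [coeffMatrix, Matrix.mul_apply, Matrix.of_apply, PiLp.smul_apply,
          RingHom.id_apply, Finset.smul_sum, mul_smul_comm]
      norm_map' := fun z => by
        have h := trace_mul_conjTranspose_eq_norm_sq
          (WithLp.toLp 2 fun p => (Wᴴ * coeffMatrix z) p.1 p.2 : EuclideanSpace ℂ (n × σ))
        have h1 : coeffMatrix (WithLp.toLp 2 fun p => (Wᴴ * coeffMatrix z) p.1 p.2 :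
            EuclideanSpace ℂ (n × σ)) = Wᴴ * coeffMatrix z := rfl
        have hW' : W * Wᴴ = 1 := Matrix.mem_unitaryGroup_iff.1 hW
        rw [h1, Matrix.conjTranspose_mul, Matrix.conjTranspose_conjTranspose, Matrix.trace_mul_comm,
          Matrix.mul_assoc, ← Matrix.mul_assoc W, hW', Matrix.one_mul, Matrix.trace_mul_comm,
          trace_mul_conjTranspose_eq_norm_sq] at h
        have h2 := Complex.ofReal_injective h
        exact ((sq_eq_sq₀ (norm_nonneg _) (norm_nonneg _)).1 h2).symm } rfl

theorem unitaryRotation_apply [DecidableEq n] (W : Matrix n n ℂ)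
    (hW : W ∈ Matrix.unitaryGroup n ℂ) (z : EuclideanSpace ℂ (n × σ)) (p : n × σ) :
    unitaryRotation W hW z p = (Wᴴ * coeffMatrix z) p.1 p.2 := rfl

theorem trace_gram_mul_conj_diagonal [DecidableEq n] (W : Matrix n n ℂ)
    (hW : W ∈ Matrix.unitaryGroup n ℂ) (w : n → ℝ) (z : EuclideanSpace ℂ (n × σ)) :
    (coeffMatrix z * (coeffMatrix z)ᴴ * (W * Matrix.diagonal (fun a => (w a : ℂ)) * Wᴴ)).trace =
      ((∑ p : n × σ, w p.1 * ‖unitaryRotation W hW z p‖ ^ 2 : ℝ) : ℂ) := by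
  simp only [unitaryRotation_apply]
  rw [← trace_mul_conjTranspose_mul_diagonal, Matrix.conjTranspose_mul,
    Matrix.conjTranspose_conjTranspose, ← Matrix.mul_assoc, Matrix.trace_mul_comm]
  simp only [Matrix.mul_assoc]

/-- The Gaussian tail bound is applied in an orthonormal basis rotated by `W`. Each complex
coordinate consists of two real ones, which cancels the factor `1/2` in the real mean and variance.
-/
theorem gaussianOn_weighted_tail [DecidableEq n] (W : Matrix n n ℂ)
    (hW : W ∈ Matrix.unitaryGroup n ℂ) (w : n → ℝ) (hw : ∀ a, |w a| ≤ 1 / 2) (t : ℝ) :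
    gaussianOn (EuclideanSpace ℂ (n × σ)) {z | t + Fintype.card σ * ∑ a, w a ≤
      ∑ p : n × σ, w p.1 * ‖unitaryRotation W hW z p‖ ^ 2} ≤
      ENNReal.ofReal (Real.exp (-t + Fintype.card σ * ∑ a, w a ^ 2)) := by
  let e : OrthonormalBasis ((_ : n × σ) × Fin 2) ℝ (EuclideanSpace ℂ (n × σ)) :=
    Pi.orthonormalBasis fun _ : n × σ => Complex.orthonormalBasisOneI
  let b := e.map (unitaryRotation (σ := σ) W hW).symm
  have hb : ∀ z p, ∑ j, b.repr z ⟨p, j⟩ ^ 2 = ‖unitaryRotation W hW z p‖ ^ 2 := by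
    intro z p
    have h1 : ∀ j, b.repr z ⟨p, j⟩ =
        Complex.orthonormalBasisOneI.repr (unitaryRotation W hW z p) j := fun j => rfl
    simp only [h1]
    rw [← EuclideanSpace.real_norm_sq_eq, LinearIsometryEquiv.norm_map]
  have key := gaussianOn_quadratic_tail b (fun i => w i.1.1) (fun i => hw _) t
  have hsum : ∀ f : n → ℝ, (∑ i : (_ : n × σ) × Fin 2, f i.1.1) / 2 =
      Fintype.card σ * ∑ a, f a := by
    intro f
    rw [Fintype.sum_sigma, Fintype.sum_prod_type]
    simp [Finset.mul_sum, Finset.sum_div]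
    refine Finset.sum_congr rfl fun a _ => by ring
  rw [hsum w, hsum fun a => w a ^ 2] at key
  refine le_trans (measure_mono fun z hz => ?_) key
  simp only [Set.mem_ofPred_eq] at hz ⊢
  rw [Fintype.sum_sigma]
  simp only [← Finset.mul_sum, hb]
  exact hz

/-- Concentration of the quadratic form `tr (G Gᴴ M)` for `M = W diag(w) Wᴴ`. -/
theorem gaussianOn_trace_tail [DecidableEq n] {W : Matrix n n ℂ}
    (hW : W ∈ Matrix.unitaryGroup n ℂ) (w : n → ℝ) {τ v : ℝ} (hτ : 0 < τ)
    (hw : ∀ a, τ * |w a| ≤ 1 / 2) (hv : ∑ a, w a ^ 2 ≤ v) (t : ℝ) :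
    gaussianOn (EuclideanSpace ℂ (n × σ)) {z | t ≤ |(coeffMatrix z * (coeffMatrix z)ᴴ *
      (W * Matrix.diagonal (fun a => (w a : ℂ)) * Wᴴ)).trace.re - Fintype.card σ * ∑ a, w a|} ≤
      ENNReal.ofReal (2 * Real.exp (-(τ * t) + τ ^ 2 * Fintype.card σ * v)) := by
  have h1 := gaussianOn_weighted_tail (σ := σ) W hW (fun a => τ * w a)
    (fun a => by rw [abs_mul, abs_of_pos hτ]; exact hw a) (τ * t)
  have h2 := gaussianOn_weighted_tail (σ := σ) W hW (fun a => -τ * w a)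
    (fun a => by rw [abs_mul, abs_neg, abs_of_pos hτ]; exact hw a) (τ * t)
  have hle : ENNReal.ofReal (Real.exp (-(τ * t) + Fintype.card σ * (τ ^ 2 * ∑ a, w a ^ 2))) ≤
      ENNReal.ofReal (Real.exp (-(τ * t) + τ ^ 2 * Fintype.card σ * v)) := by
    refine ENNReal.ofReal_le_ofReal (Real.exp_le_exp.2 ?_)
    have : (Fintype.card σ : ℝ) * (τ ^ 2 * ∑ a, w a ^ 2) ≤ Fintype.card σ * (τ ^ 2 * v) := by
      gcongr
    linarith
  simp only [mul_assoc, mul_pow, neg_sq, ← Finset.mul_sum] at h1 h2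
  rw [two_mul, ENNReal.ofReal_add (by positivity) (by positivity)]
  refine le_trans (measure_mono fun z hz => ?_)
    ((measure_union_le _ _).trans (add_le_add (h1.trans hle) (h2.trans hle)))
  rw [Set.mem_ofPred_eq, trace_gram_mul_conj_diagonal W hW, Complex.ofReal_re] at hz
  simp only [Set.mem_union, Set.mem_ofPred_eq]
  rcases le_abs.1 hz with h | h
  · left
    nlinarith [mul_le_mul_of_nonneg_left h hτ.le]
  · right
    nlinarith [mul_le_mul_of_nonneg_left h hτ.le]

theorem Matrix.IsHermitian.eq_conj_diagonal [DecidableEq n] {M : Matrix n n ℂ}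
    (hM : M.IsHermitian) :
    M = (hM.eigenvectorUnitary : Matrix n n ℂ) *
      Matrix.diagonal (fun a => (hM.eigenvalues a : ℂ)) *
        (hM.eigenvectorUnitary : Matrix n n ℂ)ᴴ := by
  conv_lhs => rw [hM.spectral_theorem, Unitary.conjStarAlgAut_apply]
  rfl

theorem Matrix.IsHermitian.sum_eigenvalues_sq [DecidableEq n] {M : Matrix n n ℂ}
    (hM : M.IsHermitian) : ((∑ a, hM.eigenvalues a ^ 2 : ℝ) : ℂ) = (M * M).trace := by
  have hU : (hM.eigenvectorUnitary : Matrix n n ℂ)ᴴ * hM.eigenvectorUnitary = 1 :=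
    Matrix.mem_unitaryGroup_iff'.1 hM.eigenvectorUnitary.2
  have key : ∀ (U D : Matrix n n ℂ), Uᴴ * U = 1 →
      (U * D * Uᴴ * (U * D * Uᴴ)).trace = (D * D).trace := by
    intro U D h
    rw [Matrix.mul_assoc (U * D), ← Matrix.mul_assoc Uᴴ, ← Matrix.mul_assoc Uᴴ, h, Matrix.one_mul,
      Matrix.trace_mul_comm, Matrix.mul_assoc, ← Matrix.mul_assoc Uᴴ, h, Matrix.one_mul]
  conv_rhs => rw [hM.eq_conj_diagonal]
  rw [key _ _ hU, Matrix.diagonal_mul_diagonal, Matrix.trace_diagonal]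
  push_cast
  simp [sq]

theorem gaussianOn_hermitian_tail [DecidableEq n] {M : Matrix n n ℂ} (hM : M.IsHermitian)
    {τ v : ℝ} (hτ : 0 < τ) (hw : ∀ a, τ * |hM.eigenvalues a| ≤ 1 / 2)
    (hv : (M * M).trace.re ≤ v) (t : ℝ) :
    gaussianOn (EuclideanSpace ℂ (n × σ)) {z | t ≤ |(coeffMatrix z * (coeffMatrix z)ᴴ *
      M).trace.re - Fintype.card σ * M.trace.re|} ≤
      ENNReal.ofReal (2 * Real.exp (-(τ * t) + τ ^ 2 * Fintype.card σ * v)) := by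
  have htr : M.trace.re = ∑ a, hM.eigenvalues a := by
    rw [hM.trace_eq_sum_eigenvalues]
    simp
  have hv' : ∑ a, hM.eigenvalues a ^ 2 ≤ v := by
    rwa [← hM.sum_eigenvalues_sq, Complex.ofReal_re] at hv
  have h := gaussianOn_trace_tail (σ := σ) hM.eigenvectorUnitary.2 hM.eigenvalues hτ hw hv' t
  rw [← hM.eq_conj_diagonal] at h
  rwa [htr]

theorem gaussianOn_unit_tail [DecidableEq n] {M : Matrix n n ℂ} (hM : M.IsHermitian)
    {τ : ℝ} (hτ : 0 < τ) (hτ' : τ ≤ 1 / 2) (hv : (M * M).trace.re ≤ 1) (t : ℝ) :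
    gaussianOn (EuclideanSpace ℂ (n × σ)) {z | t ≤ |(coeffMatrix z * (coeffMatrix z)ᴴ *
      M).trace.re - Fintype.card σ * M.trace.re|} ≤
      ENNReal.ofReal (2 * Real.exp (-(τ * t) + τ ^ 2 * Fintype.card σ)) := by
  have h := gaussianOn_hermitian_tail (σ := σ) hM hτ (fun a => ?_) hv t
  · simpa using h
  · have h1 : hM.eigenvalues a ^ 2 ≤ ∑ a, hM.eigenvalues a ^ 2 :=
      Finset.single_le_sum (f := fun a => hM.eigenvalues a ^ 2) (fun _ _ => sq_nonneg _)
        (Finset.mem_univ a)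
    rw [← hM.sum_eigenvalues_sq, Complex.ofReal_re] at hv
    have h2 : |hM.eigenvalues a| ≤ 1 := by
      rw [← sq_le_one_iff_abs_le_one]
      linarith
    nlinarith [abs_nonneg (hM.eigenvalues a)]

/-- The eigenvalues of `X ⊗ Y` are products. The variance term uses only the Hilbert–Schmidt norms,
while `τ` may be as large as `1/(2αβ)`: a small operator norm in one factor permits a much stronger
tail. -/
theorem gaussianOn_kronecker_tail {m : Type*} [Fintype m] [DecidableEq m] [DecidableEq n]
    {X : Matrix m m ℂ} {Y : Matrix n n ℂ} (hX : X.IsHermitian) (hY : Y.IsHermitian)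
    {τ α β : ℝ} (hτ : 0 < τ) (hα : ∀ a, |hX.eigenvalues a| ≤ α) (hβ : ∀ a, |hY.eigenvalues a| ≤ β)
    (hαβ : τ * (α * β) ≤ 1 / 2) (hX1 : (X * X).trace.re ≤ 1) (hY1 : (Y * Y).trace.re ≤ 1) (t : ℝ) :
    gaussianOn (EuclideanSpace ℂ ((m × n) × σ)) {z | t ≤ |(coeffMatrix z * (coeffMatrix z)ᴴ *
      (X ⊗ₖ Y)).trace.re - Fintype.card σ * (X.trace.re * Y.trace.re)|} ≤
      ENNReal.ofReal (2 * Real.exp (-(τ * t) + τ ^ 2 * Fintype.card σ)) := by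
  rw [← hX.sum_eigenvalues_sq, Complex.ofReal_re] at hX1
  rw [← hY.sum_eigenvalues_sq, Complex.ofReal_re] at hY1
  have h := gaussianOn_trace_tail (σ := σ) (Matrix.kronecker_mem_unitary
    hX.eigenvectorUnitary.2 hY.eigenvectorUnitary.2)
    (fun p => hX.eigenvalues p.1 * hY.eigenvalues p.2) (v := 1) hτ (fun p => ?_) ?_ t
  · have hM : ((hX.eigenvectorUnitary : Matrix m m ℂ) ⊗ₖ (hY.eigenvectorUnitary : Matrix n n ℂ)) *
        Matrix.diagonal (fun p : m × n => ((hX.eigenvalues p.1 * hY.eigenvalues p.2 : ℝ) : ℂ)) *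
        ((hX.eigenvectorUnitary : Matrix m m ℂ) ⊗ₖ (hY.eigenvectorUnitary : Matrix n n ℂ))ᴴ =
        X ⊗ₖ Y := by
      conv_rhs => rw [hX.eq_conj_diagonal, hY.eq_conj_diagonal]
      rw [Matrix.mul_kronecker_mul, Matrix.mul_kronecker_mul, Matrix.conjTranspose_kronecker,
        Matrix.diagonal_kronecker_diagonal]
      simp
    have hs : ∑ p : m × n, hX.eigenvalues p.1 * hY.eigenvalues p.2 = X.trace.re * Y.trace.re := by
      rw [hX.trace_eq_sum_eigenvalues, hY.trace_eq_sum_eigenvalues, Fintype.sum_prod_type]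
      simp [Finset.sum_mul_sum]
    rw [hM, hs, mul_one] at h
    exact h
  · rw [abs_mul]
    refine le_trans ?_ hαβ
    have := (abs_nonneg _).trans (hα p.1)
    gcongr
    exacts [hα _, hβ _]
  · simp only [mul_pow, Fintype.sum_prod_type]
    rw [← Finset.sum_mul_sum]
    exact mul_le_one₀ hX1 (Finset.sum_nonneg fun _ _ => sq_nonneg _) hY1

end Tails

/-! ### Trace norm: duality, a rank-one perturbation bound, realignment. -/

section TraceNorm

open scoped InnerProductSpace

variable {m n : Type*} [Fintype m] [Fintype n]

/-- The columns of a matrix as vectors of a Euclidean space. -/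
def colVec {m n : Type*} (A : Matrix m n ℂ) (j : n) : EuclideanSpace ℂ m :=
  WithLp.toLp 2 fun i => A i j

theorem inner_colVec {m n k : Type*} [Fintype m] (A : Matrix m n ℂ) (B : Matrix m k ℂ) (i : n) (j : k) :
    ⟪colVec A i, colVec B j⟫_ℂ = (Aᴴ * B) i j := by
  simp [colVec, PiLp.inner_apply, Matrix.mul_apply, mul_comm]

theorem trace_conjTranspose_mul_eq_sum_inner (A B : Matrix m n ℂ) :
    (Aᴴ * B).trace = ∑ i, ⟪colVec A i, colVec B i⟫_ℂ := by
  simp [inner_colVec, Matrix.trace]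

/-- The right singular vectors of a matrix, as the columns of a unitary matrix. -/
noncomputable def rightSingular [DecidableEq n] (A : Matrix m n ℂ) : Matrix n n ℂ :=
  (Matrix.isHermitian_conjTranspose_mul_self A).eigenvectorUnitary

theorem rightSingular_mul_conjTranspose [DecidableEq n] (A : Matrix m n ℂ) :
    rightSingular A * (rightSingular A)ᴴ = 1 :=
  Matrix.mem_unitaryGroup_iff.1
    (Matrix.isHermitian_conjTranspose_mul_self A).eigenvectorUnitary.2

theorem conjTranspose_mul_rightSingular [DecidableEq n] (A : Matrix m n ℂ) :
    (rightSingular A)ᴴ * rightSingular A = 1 :=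
  Matrix.mem_unitaryGroup_iff'.1
    (Matrix.isHermitian_conjTranspose_mul_self A).eigenvectorUnitary.2

theorem norm_colVec_rightSingular [DecidableEq n] (A : Matrix m n ℂ) (i : n) :
    ‖colVec (rightSingular A) i‖ = 1 := by
  have h : ⟪colVec (rightSingular A) i, colVec (rightSingular A) i⟫_ℂ = 1 := by
    rw [inner_colVec, conjTranspose_mul_rightSingular, Matrix.one_apply_eq]
  have h2 := inner_self_eq_norm_sq (𝕜 := ℂ) (colVec (rightSingular A) i)
  rw [h, RCLike.one_re] at h2
  exact (pow_eq_one_iff_of_nonneg (norm_nonneg _) two_ne_zero).1 h2.symm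

theorem inner_colVec_mul_rightSingular [DecidableEq n] (A : Matrix m n ℂ) (i j : n) :
    ⟪colVec (A * rightSingular A) i, colVec (A * rightSingular A) j⟫_ℂ =
      if i = j then ((Matrix.isHermitian_conjTranspose_mul_self A).eigenvalues i : ℂ) else 0 := by
  have h1 := (Matrix.isHermitian_conjTranspose_mul_self A).eq_conj_diagonal
  have h2 : (A * rightSingular A)ᴴ * (A * rightSingular A) = Matrix.diagonal
      fun i => ((Matrix.isHermitian_conjTranspose_mul_self A).eigenvalues i : ℂ) := by
    calc _ = (rightSingular A)ᴴ * (Aᴴ * A) * rightSingular A := by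
          rw [Matrix.conjTranspose_mul]
          simp only [Matrix.mul_assoc]
      _ = ((rightSingular A)ᴴ * rightSingular A) * Matrix.diagonal
            (fun i => ((Matrix.isHermitian_conjTranspose_mul_self A).eigenvalues i : ℂ)) *
              ((rightSingular A)ᴴ * rightSingular A) := by
          conv_lhs => rw [h1]
          simp only [Matrix.mul_assoc, rightSingular]
      _ = _ := by rw [conjTranspose_mul_rightSingular, Matrix.one_mul, Matrix.mul_one]
  rw [inner_colVec, h2, Matrix.diagonal_apply]

theorem norm_colVec_mul_rightSingular [DecidableEq n] (A : Matrix m n ℂ) (i : n) :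
    ‖colVec (A * rightSingular A) i‖ =
      √((Matrix.isHermitian_conjTranspose_mul_self A).eigenvalues i) := by
  have h := inner_colVec_mul_rightSingular A i i
  have h2 : ‖colVec (A * rightSingular A) i‖ ^ 2 =
      (Matrix.isHermitian_conjTranspose_mul_self A).eigenvalues i := by
    rw [← inner_self_eq_norm_sq (𝕜 := ℂ), h, if_pos rfl]
    simp
  rw [← h2, Real.sqrt_sq (norm_nonneg _)]

theorem traceNorm_eq_sum_norm [DecidableEq n] (A : Matrix m n ℂ) :
    traceNorm A = ∑ i, ‖colVec (A * rightSingular A) i‖ := by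
  simp only [norm_colVec_mul_rightSingular, traceNorm]

/-- `B` has operator norm at most `κ`. -/
def OpBound (B : Matrix m n ℂ) (κ : ℝ) : Prop :=
  ∀ (x : EuclideanSpace ℂ m) (y : EuclideanSpace ℂ n),
    ‖∑ i, ∑ j, star (x i) * B i j * y j‖ ≤ κ * ‖x‖ * ‖y‖

/-- The trace is evaluated in the basis of right singular vectors of `A`, where the images under `A`
have norms summing to `traceNorm A`. -/
theorem re_trace_le_mul_traceNorm [DecidableEq n] (A B : Matrix m n ℂ) {κ : ℝ}
    (hB : OpBound B κ) : (Aᴴ * B).trace.re ≤ κ * traceNorm A := by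
  set U := rightSingular A with hU
  have h1 : (Aᴴ * B).trace = ∑ i, ⟪colVec (A * U) i, colVec (B * U) i⟫_ℂ := by
    rw [← trace_conjTranspose_mul_eq_sum_inner, Matrix.conjTranspose_mul, Matrix.mul_assoc,
      Matrix.trace_mul_comm Uᴴ, Matrix.mul_assoc, Matrix.mul_assoc,
      rightSingular_mul_conjTranspose, Matrix.mul_one]
  have h2 : ∀ i, ‖⟪colVec (A * U) i, colVec (B * U) i⟫_ℂ‖ ≤ κ * ‖colVec (A * U) i‖ := by
    intro i
    have h3 := hB (colVec (A * U) i) (colVec U i)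
    rw [norm_colVec_rightSingular, mul_one] at h3
    convert h3 using 2
    simp only [PiLp.inner_apply, RCLike.inner_apply, colVec, Matrix.mul_apply (M := B),
      Finset.sum_mul]
    refine Finset.sum_congr rfl fun p _ => Finset.sum_congr rfl fun q _ => ?_
    rw [starRingEnd_apply]
    ring
  rw [h1, traceNorm_eq_sum_norm, Finset.mul_sum]
  refine (Complex.re_le_norm _).trans ((norm_sum_le _ _).trans (Finset.sum_le_sum fun i _ => h2 i))

theorem sum_norm_sq_colVec (A : Matrix m n ℂ) :
    ∑ i, ‖colVec A i‖ ^ 2 = ∑ p, ∑ q, ‖A p q‖ ^ 2 := by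
  simp only [EuclideanSpace.norm_sq_eq, colVec]
  exact Finset.sum_comm

theorem sum_norm_sq_mul_unitary (A : Matrix m n ℂ) {U : Matrix n n ℂ} [DecidableEq n]
    (hU : U * Uᴴ = 1) : ∑ p, ∑ q, ‖(A * U) p q‖ ^ 2 = ∑ p, ∑ q, ‖A p q‖ ^ 2 := by
  have h : ∀ C : Matrix m n ℂ, ((∑ p, ∑ q, ‖C p q‖ ^ 2 : ℝ) : ℂ) = (C * Cᴴ).trace := by
    intro C
    simp [Matrix.trace, Matrix.mul_apply, Complex.mul_conj, Complex.normSq_eq_norm_sq]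
  apply Complex.ofReal_injective
  rw [h, h, Matrix.conjTranspose_mul, Matrix.mul_assoc, ← Matrix.mul_assoc U, hU, Matrix.one_mul]

/-- The images `a i` of the right singular vectors are orthogonal. Pairing each with its own
direction splits `‖a i‖` into a `B`-part, summed by Cauchy–Schwarz, and a rank-one part, summed by
Cauchy–Schwarz and Bessel's inequality. -/
theorem traceNorm_add_rankOne_le [DecidableEq n] (B : Matrix m n ℂ) (u : EuclideanSpace ℂ m)
    (v : EuclideanSpace ℂ n) :
    traceNorm (B + Matrix.of fun p q => u p * star (v q)) ≤
      √(Fintype.card n) * √(∑ p, ∑ q, ‖B p q‖ ^ 2) + ‖u‖ * ‖v‖ := by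
  set A := B + Matrix.of fun p q => u p * star (v q) with hA
  set U := rightSingular A with hU
  set a : n → EuclideanSpace ℂ m := colVec (A * U) with ha
  set β : n → ℂ := fun i => ∑ q, star (v q) * U q i with hβ
  have hsplit : ∀ i, a i = colVec (B * U) i + β i • u := by
    intro i
    ext p
    simp [ha, colVec, hA, Matrix.add_mul, Matrix.mul_apply, hβ, Finset.mul_sum, mul_comm]
    exact Finset.sum_congr rfl fun _ _ => mul_assoc _ _ _
  have hβsum : ∑ i, ‖β i‖ ^ 2 = ‖v‖ ^ 2 := by
    have h := sum_norm_sq_mul_unitary (Matrix.of fun (_ : Unit) q => star (v q))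
      (rightSingular_mul_conjTranspose A)
    rw [EuclideanSpace.norm_sq_eq]
    simpa [Matrix.mul_apply, hβ] using h
  classical
  -- Zero columns contribute nothing and cannot be normalised, so they are dropped.
  let ι := {i : n // a i ≠ 0}
  let w : ι → EuclideanSpace ℂ m := fun i => ((‖a i‖⁻¹ : ℝ) : ℂ) • a i
  have hw : Orthonormal ℂ w := by
    constructor
    · intro i
      have : ‖a i‖ ≠ 0 := norm_ne_zero_iff.2 i.2
      simp [w, norm_smul, this]
    · intro i j hij
      have hij' : (i : n) ≠ j := fun h => hij (Subtype.ext h)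
      have h := inner_colVec_mul_rightSingular A i j
      rw [if_neg hij'] at h
      simp only [w, inner_smul_left, inner_smul_right]
      have h' : ⟪a i, a j⟫_ℂ = 0 := h
      rw [h']
      simp
  have hterm : ∀ i : ι, ‖a i‖ ≤ ‖colVec (B * U) i‖ + ‖⟪w i, u⟫_ℂ‖ * ‖β i‖ := by
    intro i
    have h1 : ⟪w i, a i⟫_ℂ = ‖a i‖ := by
      have : (‖a i‖ : ℂ) ≠ 0 := by exact_mod_cast norm_ne_zero_iff.2 i.2
      simp only [w, inner_smul_left, inner_self_eq_norm_sq_to_K]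
      simp
      field_simp
    have h2 : ‖a i‖ = ‖⟪w i, a i⟫_ℂ‖ := by rw [h1]; simp
    calc ‖a i‖ = ‖⟪w i, colVec (B * U) i⟫_ℂ + β i * ⟪w i, u⟫_ℂ‖ := by
          rw [h2]
          conv_lhs => rw [hsplit i, inner_add_right, inner_smul_right]
      _ ≤ ‖⟪w i, colVec (B * U) i⟫_ℂ‖ + ‖β i‖ * ‖⟪w i, u⟫_ℂ‖ := by
          rw [← norm_mul]
          exact norm_add_le _ _
      _ ≤ _ := by
          have := norm_inner_le_norm (𝕜 := ℂ) (w i) (colVec (B * U) i)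
          rw [hw.1 i, one_mul] at this
          linarith [mul_comm ‖β i‖ ‖⟪w i, u⟫_ℂ‖]
  have hsub : ∀ f : n → ℝ, (∀ i, 0 ≤ f i) → ∑ i : ι, f i ≤ ∑ i, f i := by
    intro f hf
    rw [← Finset.sum_subtype (Finset.univ.filter fun i => a i ≠ 0) (by simp) f]
    exact Finset.sum_le_sum_of_subset_of_nonneg (Finset.filter_subset _ _) fun i _ _ => hf i
  have hsum : ∑ i, ‖a i‖ = ∑ i : ι, ‖a i‖ := by
    rw [← Finset.sum_subtype (Finset.univ.filter fun i => a i ≠ 0) (by simp) fun i => ‖a i‖]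
    refine (Finset.sum_subset (Finset.filter_subset _ _) fun i _ hi => ?_).symm
    simpa using hi
  have hB : ∑ i, ‖colVec (B * U) i‖ ≤ √(Fintype.card n) * √(∑ p, ∑ q, ‖B p q‖ ^ 2) := by
    rw [← Real.sqrt_mul (by positivity)]
    refine Real.le_sqrt_of_sq_le ?_
    rw [← sum_norm_sq_mul_unitary B (rightSingular_mul_conjTranspose A), ← sum_norm_sq_colVec]
    simpa using sq_sum_le_card_mul_sum_sq (s := Finset.univ)
      (f := fun i => ‖colVec (B * U) i‖)
  have hu : ∑ i : ι, ‖⟪w i, u⟫_ℂ‖ * ‖β i‖ ≤ ‖u‖ * ‖v‖ := by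
    have h1 := Finset.sum_mul_sq_le_sq_mul_sq Finset.univ (fun i : ι => ‖⟪w i, u⟫_ℂ‖)
      fun i : ι => ‖β i‖
    have h2 : ∑ i : ι, ‖⟪w i, u⟫_ℂ‖ ^ 2 ≤ ‖u‖ ^ 2 := hw.sum_inner_products_le u
    have h3 : ∑ i : ι, ‖β i‖ ^ 2 ≤ ‖v‖ ^ 2 := by
      rw [← hβsum]
      exact hsub (fun i => ‖β i‖ ^ 2) fun i => by positivity
    refine abs_le_of_sq_le_sq' ?_ (by positivity) |>.2
    rw [mul_pow]
    refine h1.trans ?_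
    gcongr
  rw [traceNorm_eq_sum_norm]
  change ∑ i, ‖a i‖ ≤ _
  rw [hsum]
  calc ∑ i : ι, ‖a i‖ ≤ ∑ i : ι, (‖colVec (B * U) i‖ + ‖⟪w i, u⟫_ℂ‖ * ‖β i‖) :=
        Finset.sum_le_sum fun i _ => hterm i
    _ ≤ _ := by
        rw [Finset.sum_add_distrib]
        exact add_le_add ((hsub (fun i => ‖colVec (B * U) i‖) fun i => norm_nonneg _).trans hB) hu

theorem trace_realign {ι : Type*} [Fintype ι] (A B : Matrix (ι × ι) (ι × ι) ℂ) :
    ((realign A)ᴴ * realign B).trace = (Aᴴ * B).trace := by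
  simp only [Matrix.trace, Matrix.diag_apply, Matrix.mul_apply, Matrix.conjTranspose_apply, realign,
    Matrix.of_apply, Fintype.sum_prod_type]
  calc _ = ∑ j, ∑ l, ∑ i, ∑ k, star (A (i, j) (k, l)) * B (i, j) (k, l) := rfl
    _ = ∑ k, ∑ l, ∑ i, ∑ j, star (A (i, j) (k, l)) * B (i, j) (k, l) := by
      rw [Finset.sum_comm]
      have h : ∀ l, ∑ j, ∑ i, ∑ k, star (A (i, j) (k, l)) * B (i, j) (k, l) =
          ∑ k, ∑ i, ∑ j, star (A (i, j) (k, l)) * B (i, j) (k, l) := by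
        intro l
        rw [Finset.sum_comm, Finset.sum_congr rfl fun i _ => Finset.sum_comm, Finset.sum_comm]
      rw [Finset.sum_congr rfl fun l _ => h l, Finset.sum_comm]

variable {ι : Type*} [Fintype ι] [DecidableEq ι]

theorem one_lt_traceNorm_realign {ρ : Matrix (ι × ι) (ι × ι) ℂ} {C : Matrix (ι × ι) (ι × ι) ℂ}
    {κ : ℝ} (hκ : 0 < κ) (h1 : 2 * κ ≤ (ρᴴ * C).trace.re) (h2 : OpBound (realign C) κ) :
    1 < traceNorm (realign ρ) := by
  have h := re_trace_le_mul_traceNorm (realign ρ) (realign C) h2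
  rw [trace_realign] at h
  nlinarith

/-- The maximally mixed state realigns to `d⁻² v vᴴ`, with `v` the unnormalised maximally entangled
vector and `‖v‖² = d`. The remainder contributes at most `d · 1/(2d)`. -/
theorem traceNorm_realign_le_one {ρ : Matrix (ι × ι) (ι × ι) ℂ} (hd : 2 ≤ Fintype.card ι)
    (h : ∑ a, ∑ b, ‖(ρ - ((Fintype.card ι : ℂ) ^ 2)⁻¹ • (1 : Matrix (ι × ι) (ι × ι) ℂ)) a b‖ ^ 2 ≤
      (1 / (2 * Fintype.card ι : ℝ)) ^ 2) :
    traceNorm (realign ρ) ≤ 1 := by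
  set d := Fintype.card ι with hd'
  have hd0 : (2 : ℝ) ≤ d := by exact_mod_cast hd
  set C := ρ - ((d : ℂ) ^ 2)⁻¹ • (1 : Matrix (ι × ι) (ι × ι) ℂ) with hC
  let v : EuclideanSpace ℂ (ι × ι) := WithLp.toLp 2 fun p => if p.1 = p.2 then 1 else 0
  have hv : ‖v‖ ^ 2 = d := by
    rw [EuclideanSpace.norm_sq_eq, Fintype.sum_prod_type]
    simp [v, apply_ite (fun x : ℂ => ‖x‖ ^ 2), hd']
  have hsplit : realign ρ = realign C +
      Matrix.of fun p q => ((((d : ℂ) ^ 2)⁻¹ • v) p) * star (v q) := by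
    ext ⟨i, k⟩ ⟨j, l⟩
    by_cases hik : i = k <;> by_cases hjl : j = l <;>
      simp [realign, hC, v, Matrix.one_apply, hik, hjl]
  have hHS : ∑ p, ∑ q, ‖realign C p q‖ ^ 2 = ∑ a, ∑ b, ‖C a b‖ ^ 2 := by
    simp only [realign, Matrix.of_apply, Fintype.sum_prod_type]
    exact Finset.sum_congr rfl fun i _ => Finset.sum_comm
  rw [hsplit]
  refine (traceNorm_add_rankOne_le _ _ _).trans ?_
  rw [hHS, norm_smul, mul_assoc, ← sq, hv]
  have h1 : √(∑ a, ∑ b, ‖C a b‖ ^ 2) ≤ 1 / (2 * d) :=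
    Real.sqrt_le_iff.2 ⟨by positivity, h⟩
  have h2 : √((Fintype.card (ι × ι) : ℕ) : ℝ) = d := by
    rw [Fintype.card_prod, Nat.cast_mul, Real.sqrt_mul_self (by positivity)]
  have h3 : ‖((d : ℂ) ^ 2)⁻¹‖ * d = 1 / d := by
    simp only [norm_inv, norm_pow, Complex.norm_natCast]
    field_simp
  rw [h2, h3]
  have h4 : (d : ℝ) * √(∑ a, ∑ b, ‖C a b‖ ^ 2) ≤ d * (1 / (2 * d)) := by gcongr
  have h5 : (d : ℝ) * (1 / (2 * d)) = 1 / 2 := by field_simp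
  have h6 : 1 / (d : ℝ) ≤ 1 / 2 := by gcongr
  linarith

end TraceNorm

/-! ### Transfer of Gaussian bounds to the induced state. -/

section Sphere

variable {n σ : Type*} [Fintype n] [Fintype σ]

/-- `T` is the bad Gaussian event: the whole ray over a bad state lies in it. The measurable set `D`
avoids any measurability question about the trace norm, which enters only through `D'`. -/
theorem inducedState_real_ge [Nonempty n] [Nonempty σ] {D D' : Set (Matrix n n ℂ)}
    (hD : MeasurableSet D) (hDD : D ⊆ D') {T : Set (EuclideanSpace ℂ (n × σ))} {p : ℝ}
    (hp : 0 ≤ p) (hT : gaussianOn (EuclideanSpace ℂ (n × σ)) T ≤ ENNReal.ofReal p)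
    (h : ∀ ψ : EuclideanSpace ℂ (n × σ), ‖ψ‖ = 1 → ∀ r : ℝ, 0 < r → r • ψ ∉ T →
      coeffMatrix ψ * (coeffMatrix ψ)ᴴ ∈ D) :
    1 - p ≤ (inducedState n σ).real D' := by
  have := isProbabilityMeasure_uniformSphere (EuclideanSpace ℂ (n × σ))
  have := isProbabilityMeasure_inducedState n σ
  refine le_trans ?_ (measureReal_mono hDD)
  have hm := measurable_partialTraceRight_ketbra n σ
  have h1 : (inducedState n σ).real Dᶜ ≤ p := by
    rw [inducedState, map_measureReal_apply hm hD.compl]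
    refine ENNReal.toReal_le_of_le_ofReal hp ?_
    refine (uniformSphere_le_gaussianOn (T := T) (hm hD.compl) fun ψ hψ r hr => ?_).trans hT
    by_contra hcon
    refine hψ ?_
    change partialTraceRight (ketbra (ψ : EuclideanSpace ℂ (n × σ))) ∈ D
    rw [partialTraceRight_ketbra]
    exact h ψ (mem_sphere_zero_iff_norm.1 ψ.2) r hr hcon
  rw [probReal_compl_eq_one_sub hD] at h1
  linarith

theorem measure_iUnion_net_le {Ω V W : Type*} [MeasurableSpace Ω] {μ : Measure Ω}
    {N : Finset V} {N' : Finset W} {f : V → W → Set Ω} {p : ℝ} (hp : 0 ≤ p) {k k' : ℕ}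
    (hN : N.card ≤ 9 ^ k) (hN' : N'.card ≤ 9 ^ k')
    (h : ∀ c ∈ N, ∀ d ∈ N', μ (f c d) ≤ ENNReal.ofReal p) :
    μ (⋃ c ∈ N, ⋃ d ∈ N', f c d) ≤ ENNReal.ofReal (9 ^ (k + k') * p) := by
  have h1 : ∀ c ∈ N, μ (⋃ d ∈ N', f c d) ≤ ENNReal.ofReal (9 ^ k' * p) := by
    intro c hc
    refine (measure_biUnion_finset_le _ _).trans ((Finset.sum_le_sum fun d hd => h c hc d hd).trans ?_)
    rw [Finset.sum_const, nsmul_eq_mul, ← ENNReal.ofReal_natCast,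
      ← ENNReal.ofReal_mul (Nat.cast_nonneg _)]
    refine ENNReal.ofReal_le_ofReal ?_
    gcongr
    exact_mod_cast hN'
  refine (measure_biUnion_finset_le _ _).trans ((Finset.sum_le_sum h1).trans ?_)
  rw [Finset.sum_const, nsmul_eq_mul, ← ENNReal.ofReal_natCast,
      ← ENNReal.ofReal_mul (Nat.cast_nonneg _)]
  refine ENNReal.ofReal_le_ofReal ?_
  rw [pow_add, mul_assoc]
  gcongr
  exact_mod_cast hN

/-- The cost of a pair of nets, each in real dimension `2k`. -/
theorem nine_pow_le_exp (k : ℕ) : (9 : ℝ) ^ (4 * k) ≤ Real.exp (9 * k) := by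
  have h1 : (9 : ℝ) ^ 4 ≤ Real.exp 9 := by
    have h2 : Real.exp 9 = Real.exp 1 ^ 9 := by rw [← Real.exp_nat_mul]; norm_num
    rw [h2]
    calc (9 : ℝ) ^ 4 ≤ 2.7182818283 ^ 9 := by norm_num
      _ ≤ _ := by gcongr; exact Real.exp_one_gt_d9.le
  calc (9 : ℝ) ^ (4 * k) = (9 ^ 4) ^ k := pow_mul _ _ _
    _ ≤ Real.exp 9 ^ k := by gcongr
    _ = _ := by rw [← Real.exp_nat_mul, mul_comm]

theorem finrank_real_euclideanSpace_complex (n : Type*) [Fintype n] :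
    Module.finrank ℝ (EuclideanSpace ℂ n) = 2 * Fintype.card n := by
  rw [← Module.finrank_mul_finrank ℝ ℂ, Complex.finrank_real_complex, finrank_euclideanSpace]

instance {n : Type*} [Fintype n] : OpensMeasurableSpace (Matrix n n ℂ) :=
  inferInstanceAs (OpensMeasurableSpace (n → n → ℂ))

end Sphere

/-! ### Large environment: `G Gᴴ` is nearly a multiple of the identity. -/

section LargeEnvironment

variable {n σ : Type*} [Fintype n] [Fintype σ]

/-- The Hermitian part of the rank-one matrix `y xᴴ`. -/
noncomputable def symRankOne {n : Type*} (x y : EuclideanSpace ℂ n) : Matrix n n ℂ :=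
  (1 / 2 : ℂ) • (Matrix.of fun a b => y a * star (x b) + x a * star (y b))

theorem isHermitian_symRankOne {n : Type*} (x y : EuclideanSpace ℂ n) :
    (symRankOne x y).IsHermitian := by
  ext a b
  simp [symRankOne]
  ring

theorem trace_mul_symRankOne_self (A : Matrix n n ℂ) (x : EuclideanSpace ℂ n) :
    (A * symRankOne x x).trace = star (x : n → ℂ) ⬝ᵥ (A *ᵥ (x : n → ℂ)) := by
  simp only [Matrix.trace, Matrix.diag_apply, Matrix.mul_apply, symRankOne, Matrix.smul_apply,
    Matrix.of_apply, dotProduct, Matrix.mulVec, Finset.mul_sum, Pi.star_apply, smul_eq_mul]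
  exact Finset.sum_congr rfl fun a _ => Finset.sum_congr rfl fun b _ => by ring

theorem Matrix.IsHermitian.trace_mul_self_eq {M : Matrix n n ℂ} (hM : M.IsHermitian) :
    (M * M).trace = ((∑ a, ∑ b, ‖M a b‖ ^ 2 : ℝ) : ℂ) := by
  simp only [Matrix.trace, Matrix.diag_apply, Matrix.mul_apply]
  push_cast
  refine Finset.sum_congr rfl fun a _ => Finset.sum_congr rfl fun b _ => ?_
  rw [← hM.apply b a, Complex.star_def, Complex.mul_conj, Complex.normSq_eq_norm_sq]
  push_cast
  rfl

theorem trace_symRankOne_self (x : EuclideanSpace ℂ n) :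
    (symRankOne x x).trace.re = ‖x‖ ^ 2 := by
  simp only [Matrix.trace, Matrix.diag_apply, symRankOne, Matrix.smul_apply, Matrix.of_apply,
    EuclideanSpace.norm_sq_eq, Complex.re_sum, smul_eq_mul]
  refine Finset.sum_congr rfl fun a _ => ?_
  rw [← two_mul, ← mul_assoc, Complex.star_def, Complex.mul_conj, Complex.normSq_eq_norm_sq]
  norm_num [← Complex.ofReal_pow]

theorem trace_symRankOne_sq_le (x y : EuclideanSpace ℂ n) (hx : ‖x‖ ≤ 1) (hy : ‖y‖ ≤ 1) :
    (symRankOne x y * symRankOne x y).trace.re ≤ 1 := by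
  rw [(isHermitian_symRankOne x y).trace_mul_self_eq, Complex.ofReal_re]
  have hent : ∀ a b, ‖symRankOne x y a b‖ ^ 2 ≤
      (‖y a‖ ^ 2 * ‖x b‖ ^ 2 + ‖x a‖ ^ 2 * ‖y b‖ ^ 2) / 2 := by
    intro a b
    have h1 : ‖symRankOne x y a b‖ ≤ (‖y a‖ * ‖x b‖ + ‖x a‖ * ‖y b‖) / 2 := by
      have := norm_add_le (y a * star (x b)) (x a * star (y b))
      simp only [norm_mul, norm_star] at this
      simp only [symRankOne, Matrix.smul_apply, Matrix.of_apply, norm_smul]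
      rw [show ‖(1 / 2 : ℂ)‖ = 1 / 2 by norm_num]
      linarith
    have h2 : ‖symRankOne x y a b‖ ^ 2 ≤ ((‖y a‖ * ‖x b‖ + ‖x a‖ * ‖y b‖) / 2) ^ 2 := by gcongr
    nlinarith [sq_nonneg (‖y a‖ * ‖x b‖ - ‖x a‖ * ‖y b‖)]
  refine (Finset.sum_le_sum fun a _ => Finset.sum_le_sum fun b _ => hent a b).trans ?_
  have hsum : ∑ a, ∑ b, (‖y a‖ ^ 2 * ‖x b‖ ^ 2 + ‖x a‖ ^ 2 * ‖y b‖ ^ 2) / 2 =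
      ‖x‖ ^ 2 * ‖y‖ ^ 2 := by
    simp only [← Finset.sum_div, Finset.sum_add_distrib, ← Finset.sum_mul_sum,
      ← EuclideanSpace.norm_sq_eq]
    ring
  rw [hsum]
  exact mul_le_one₀ (pow_le_one₀ (norm_nonneg _) hx) (by positivity)
    (pow_le_one₀ (norm_nonneg _) hy)

/-- The centred quadratic form `tr (G Gᴴ M) - s tr M`. -/
noncomputable def centredForm {n : Type*} [Fintype n] (R : Matrix n n ℂ) (s : ℝ)
    (M : Matrix n n ℂ) : ℝ :=
  (R * M).trace.re - s * M.trace.re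

theorem centredForm_add (R : Matrix n n ℂ) (s : ℝ) (M M' : Matrix n n ℂ) :
    centredForm R s (M + M') = centredForm R s M + centredForm R s M' := by
  simp only [centredForm, Matrix.mul_add, Matrix.trace_add, Complex.add_re]
  ring

theorem centredForm_smul (R : Matrix n n ℂ) (s : ℝ) (c : ℝ) (M : Matrix n n ℂ) :
    centredForm R s (c • M) = c * centredForm R s M := by
  simp only [centredForm, Matrix.mul_smul, Matrix.trace_smul, Complex.smul_re, smul_eq_mul]
  ring

/-- The centred form on symmetrized rank-one matrices, as a real bilinear map. -/
noncomputable def rankOneForm (R : Matrix n n ℂ) (s : ℝ) :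
    EuclideanSpace ℂ n →ₗ[ℝ] EuclideanSpace ℂ n →ₗ[ℝ] ℝ :=
  LinearMap.mk₂ ℝ (fun x y => centredForm R s (symRankOne x y))
    (fun x x' y => by
      rw [← centredForm_add]
      congr 1
      ext a b
      simp [symRankOne]
      ring)
    (fun c x y => by
      rw [smul_eq_mul, ← centredForm_smul]
      congr 1
      ext a b
      simp [symRankOne]
      ring)
    (fun x y y' => by
      rw [← centredForm_add]
      congr 1
      ext a b
      simp [symRankOne]
      ring)
    (fun c x y => by
      rw [smul_eq_mul, ← centredForm_smul]
      congr 1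
      ext a b
      simp [symRankOne]
      ring)

/-- Testing on basis vectors puts `N` within `k s / 5` of `k s`; testing on an eigenvector then
bounds each eigenvalue of `R / N - 1 / k` by `1 / (2k)`. The sum of the `k` squares is at most `1 /
(4k)`. -/
theorem sum_norm_sq_le_of_rankOneForm [DecidableEq n] [Nonempty n] {R : Matrix n n ℂ}
    (hR : R.IsHermitian) {s N : ℝ} (hs : 0 < s) (hN : R.trace = N)
    (h : ∀ x : EuclideanSpace ℂ n, ‖x‖ ≤ 1 → |centredForm R s (symRankOne x x)| ≤ s / 5) :
    0 < N ∧ ∑ a, ∑ b, ‖((N : ℂ)⁻¹ • R - (Fintype.card n : ℂ)⁻¹ • (1 : Matrix n n ℂ)) a b‖ ^ 2 ≤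
      1 / (4 * Fintype.card n) := by
  set k : ℝ := (Fintype.card n : ℝ) with hk
  have hk0 : 0 < k := by rw [hk]; exact_mod_cast Fintype.card_pos
  have hNk : |N - s * k| ≤ k * (s / 5) := by
    have h1 : N - s * k = ∑ a, centredForm R s (symRankOne (EuclideanSpace.single a 1)
        (EuclideanSpace.single a 1)) := by
      have h2 : ∀ a : n, centredForm R s (symRankOne (EuclideanSpace.single a 1)
          (EuclideanSpace.single a 1)) = (R a a).re - s := by
        intro a
        rw [centredForm, trace_mul_symRankOne_self, trace_symRankOne_self]
        simp
      rw [Finset.sum_congr rfl fun a _ => h2 a, Finset.sum_sub_distrib]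
      have h3 : ∑ a, (R a a).re = N := by
        rw [← Complex.re_sum]
        change R.trace.re = N
        rw [hN, Complex.ofReal_re]
      rw [h3]
      simp [hk, mul_comm]
    rw [h1]
    refine (Finset.abs_sum_le_sum_abs _ _).trans
      ((Finset.sum_le_sum fun a _ => h _ (by simp)).trans ?_)
    simp [hk]
  obtain ⟨hN1, hN2⟩ := abs_le.1 hNk
  have hNpos : 4 / 5 * (k * s) ≤ N := by linarith [mul_comm s k]
  have hks : 0 < k * s := by positivity
  have hN0 : 0 < N := by linarith
  refine ⟨hN0, ?_⟩
  set C := (N : ℂ)⁻¹ • R - (Fintype.card n : ℂ)⁻¹ • (1 : Matrix n n ℂ) with hC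
  have hCH : C.IsHermitian := by
    ext a b
    have := hR.apply a b
    simp only [hC, Matrix.conjTranspose_apply, Matrix.sub_apply, Matrix.smul_apply, smul_eq_mul,
      star_sub, star_mul', this, Matrix.one_apply, star_inv₀]
    by_cases hab : a = b
    · simp [hab]
    · simp [hab, Ne.symm hab]
  have heig : ∀ i, hCH.eigenvalues i ^ 2 ≤ (1 / (2 * k)) ^ 2 := by
    intro i
    have hv : ‖hCH.eigenvectorBasis i‖ = 1 := hCH.eigenvectorBasis.orthonormal.1 i
    set v := hCH.eigenvectorBasis i with hvdef
    have h1 := h v hv.le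
    have h2 : hCH.eigenvalues i = (C * symRankOne v v).trace.re := by
      rw [trace_mul_symRankOne_self, hCH.eigenvalues_eq]
      rfl
    have h3 : (C * symRankOne v v).trace.re =
        N⁻¹ * (R * symRankOne v v).trace.re - k⁻¹ := by
      rw [hC, Matrix.sub_mul, Matrix.trace_sub, Matrix.smul_mul, Matrix.smul_mul,
        Matrix.trace_smul, Matrix.trace_smul, Matrix.one_mul, Complex.sub_re, smul_eq_mul,
        smul_eq_mul, ← Complex.ofReal_inv, Complex.re_ofReal_mul, ← Complex.ofReal_natCast,
        ← Complex.ofReal_inv, Complex.re_ofReal_mul, trace_symRankOne_self, hv]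
      simp [hk]
    rw [centredForm, trace_symRankOne_self, hv] at h1
    rw [h2, h3]
    set q := (R * symRankOne v v).trace.re
    obtain ⟨h4, h5⟩ := abs_le.1 h1
    rw [sq_le_sq, abs_of_pos (show 0 < 1 / (2 * k) by positivity)]
    have h6 : N⁻¹ * q - k⁻¹ = (q * k - N) / (N * k) := by field_simp
    rw [h6, abs_div, abs_of_pos (show 0 < N * k by positivity), div_le_div_iff₀ (by positivity)
      (by positivity)]
    -- Both `q k` and `N` lie within `k s / 5` of `k s`; division by `N ≥ 4 k s / 5` yields the
    -- factor `1/2`.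
    have h7 : |q * k - N| ≤ 2 / 5 * (k * s) := by
      rw [abs_le]
      constructor <;> nlinarith
    nlinarith
  have hfin : ∑ a, ∑ b, ‖C a b‖ ^ 2 = ∑ i, hCH.eigenvalues i ^ 2 := by
    apply Complex.ofReal_injective
    rw [← hCH.trace_mul_self_eq, hCH.sum_eigenvalues_sq]
  rw [hfin]
  refine (Finset.sum_le_sum fun i _ => heig i).trans ?_
  rw [Finset.sum_const, Finset.card_univ, nsmul_eq_mul, ← hk]
  refine le_of_eq ?_
  field_simp
  norm_num

theorem isHermitian_gram {n σ : Type*} [Fintype σ] (A : Matrix n σ ℂ) :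
    (A * Aᴴ).IsHermitian := Matrix.isHermitian_mul_conjTranspose_self A

theorem coeffMatrix_smul {n σ : Type*} (r : ℝ) (z : EuclideanSpace ℂ (n × σ)) :
    coeffMatrix (r • z) = (r : ℂ) • coeffMatrix z := by
  ext a k
  simp [coeffMatrix]

theorem gram_smul {n σ : Type*} [Fintype σ] (r : ℝ) (z : EuclideanSpace ℂ (n × σ)) :
    coeffMatrix (r • z) * (coeffMatrix (r • z))ᴴ =
      ((r ^ 2 : ℝ) : ℂ) • (coeffMatrix z * (coeffMatrix z)ᴴ) := by
  rw [coeffMatrix_smul, Matrix.conjTranspose_smul, Matrix.smul_mul, Matrix.mul_smul, smul_smul]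
  simp [sq]

/-- With `τ = 1/20` and deviation `s / 10`, the exponent is `-s / 400 ≤ -10 d²`, against a net cost
`exp (9 d²)`; this fixes the constant 4000. The net doubles the deviation to `s / 5`. -/
theorem separable_probability (d s : ℕ) (hd : 2 ≤ d) (hs : 4000 * (d : ℝ) ^ 2 ≤ s) :
    1 - 2 * Real.exp (-(d : ℝ) ^ 2) ≤
      (inducedState (Fin d × Fin d) (Fin s)).real {ρ | traceNorm (realign ρ) ≤ 1} := by
  have hd0 : (2 : ℝ) ≤ d := by exact_mod_cast hd
  have hs0 : (0 : ℝ) < s := by nlinarith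
  have hs0' : 0 < s := by exact_mod_cast hs0
  have : NeZero d := ⟨by omega⟩
  have : NeZero s := ⟨by omega⟩
  let n := Fin d × Fin d
  have hcard : Fintype.card n = d ^ 2 := by simp [n, sq]
  obtain ⟨N, hN⟩ := exists_isUnitBallNet (LinearMap.id : EuclideanSpace ℂ n →ₗ[ℝ] _)
    Function.injective_id
  let f : EuclideanSpace ℂ n → EuclideanSpace ℂ n → Set (EuclideanSpace ℂ (n × Fin s)) :=
    fun x y => {z | (s : ℝ) / 10 ≤ |(coeffMatrix z * (coeffMatrix z)ᴴ *
      symRankOne x y).trace.re - Fintype.card (Fin s) * (symRankOne x y).trace.re|}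
  have hcardN : N.card ≤ 9 ^ (2 * d ^ 2) := by
    have := hN.2.1
    rwa [finrank_real_euclideanSpace_complex, hcard] at this
  have hbad := measure_iUnion_net_le (μ := gaussianOn (EuclideanSpace ℂ (n × Fin s))) (N := N)
    (N' := N) (f := f) (p := 2 * Real.exp (-(1 / 20 * (s / 10)) + (1 / 20) ^ 2 * s)) (by positivity)
    hcardN hcardN fun x hx y hy => by
      have := gaussianOn_unit_tail (σ := Fin s) (isHermitian_symRankOne x y) (τ := 1 / 20)
        (by norm_num) (by norm_num) (trace_symRankOne_sq_le x y (hN.1 x hx) (hN.1 y hy)) (s / 10)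
      simpa only [f, Fintype.card_fin] using this
  have hD : IsClosed {ρ : Matrix n n ℂ | ∑ a, ∑ b, ‖(ρ - ((Fintype.card (Fin d) : ℂ) ^ 2)⁻¹ •
      (1 : Matrix n n ℂ)) a b‖ ^ 2 ≤ (1 / (2 * Fintype.card (Fin d) : ℝ)) ^ 2} := by
    refine isClosed_le ?_ continuous_const
    simp only [Matrix.sub_apply]
    fun_prop
  refine le_trans ?_ (inducedState_real_ge hD.measurableSet (fun ρ hρ => ?_) (by positivity) hbad ?_)
  · have h1 : (9 : ℝ) ^ (2 * d ^ 2 + 2 * d ^ 2) ≤ Real.exp (9 * (d ^ 2 : ℕ)) := by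
      rw [show 2 * d ^ 2 + 2 * d ^ 2 = 4 * d ^ 2 by ring]
      exact nine_pow_le_exp _
    have h2 : (9 : ℝ) ^ (2 * d ^ 2 + 2 * d ^ 2) *
        (2 * Real.exp (-(1 / 20 * (s / 10)) + (1 / 20) ^ 2 * s)) ≤
        Real.exp (9 * (d ^ 2 : ℕ)) * (2 * Real.exp (-(10 * (d : ℝ) ^ 2))) := by
      gcongr
      linarith
    have h3 : Real.exp (9 * (d ^ 2 : ℕ)) * (2 * Real.exp (-(10 * (d : ℝ) ^ 2))) =
        2 * Real.exp (-(d : ℝ) ^ 2) := by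
      rw [mul_left_comm, ← Real.exp_add]
      push_cast
      ring_nf
    linarith
  · exact traceNorm_realign_le_one (by simpa using hd) hρ
  · intro ψ hψ r hr hgood
    set R := coeffMatrix (r • ψ) * (coeffMatrix (r • ψ))ᴴ with hR
    have hB : ∀ x ∈ N, ∀ y ∈ N, ‖rankOneForm R s x y‖ ≤ (s : ℝ) / 10 := by
      intro x hx y hy
      by_contra hcon
      refine hgood (Set.mem_iUnion₂.2 ⟨x, hx, Set.mem_iUnion₂.2 ⟨y, hy, ?_⟩⟩)
      have := (not_le.1 hcon).le
      simpa only [f, Set.mem_ofPred_eq, Fintype.card_fin, Real.norm_eq_abs] using! this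
    have hform : ∀ x : EuclideanSpace ℂ n, ‖x‖ ≤ 1 →
        |centredForm R s (symRankOne x x)| ≤ (s : ℝ) / 5 := by
      intro x hx
      have := hN.norm_bilinear_le Function.injective_id Function.injective_id hN
        (rankOneForm R s) hB (x := x) (y := x) hx hx
      have h2 : ‖rankOneForm R s x x‖ = |centredForm R s (symRankOne x x)| := rfl
      linarith
    have hRt : R.trace = ((r ^ 2 : ℝ) : ℂ) := by
      rw [hR, trace_mul_conjTranspose_eq_norm_sq, norm_smul, hψ, mul_one, Real.norm_eq_abs, sq_abs]
    obtain ⟨h1, h2⟩ := sum_norm_sq_le_of_rankOneForm (isHermitian_gram _) hs0 hRt hform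
    have h3 : ((r ^ 2 : ℝ) : ℂ)⁻¹ • R = coeffMatrix ψ * (coeffMatrix ψ)ᴴ := by
      rw [hR, gram_smul, smul_smul, inv_mul_cancel₀ (by exact_mod_cast h1.ne'), one_smul]
    rw [h3, hcard] at h2
    simp only [Set.mem_ofPred_eq, Fintype.card_fin]
    refine le_trans (le_of_eq ?_) (h2.trans (le_of_eq ?_))
    · push_cast
      rfl
    · push_cast
      field_simp
      norm_num

end LargeEnvironment

/-! ### Hermitian parts and spectral truncation. -/

section Hermitian

open scoped Kronecker

variable {ι σ : Type*} [Fintype ι] [Fintype σ]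

/-- The squared Hilbert–Schmidt norm. -/
noncomputable def hsSq {ι : Type*} [Fintype ι] (X : Matrix ι ι ℂ) : ℝ := ∑ a, ∑ b, ‖X a b‖ ^ 2

theorem Matrix.IsHermitian.hsSq_eq_trace {X : Matrix ι ι ℂ} (hX : X.IsHermitian) :
    (X * X).trace.re = hsSq X := by
  rw [hX.trace_mul_self_eq, Complex.ofReal_re, hsSq]

theorem Matrix.IsHermitian.sum_eigenvalues_sq_eq_hsSq [DecidableEq ι] {X : Matrix ι ι ℂ}
    (hX : X.IsHermitian) : ∑ a, hX.eigenvalues a ^ 2 = hsSq X := by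
  rw [← hX.hsSq_eq_trace, ← hX.sum_eigenvalues_sq, Complex.ofReal_re]

/-- The operator norm of a square matrix. -/
noncomputable def opNorm [DecidableEq ι] (X : Matrix ι ι ℂ) : ℝ :=
  ‖Matrix.toEuclideanCLM (𝕜 := ℂ) X‖

theorem Matrix.IsHermitian.trace_im {X : Matrix ι ι ℂ} (hX : X.IsHermitian) :
    X.trace.im = 0 := by
  have h : star X.trace = X.trace := by rw [← Matrix.trace_conjTranspose, hX.eq]
  exact Complex.conj_eq_iff_im.1 h

theorem Matrix.IsHermitian.trace_mul_im {X Y : Matrix ι ι ℂ} (hX : X.IsHermitian)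
    (hY : Y.IsHermitian) : (X * Y).trace.im = 0 := by
  have h : star (X * Y).trace = (X * Y).trace := by
    rw [← Matrix.trace_conjTranspose, Matrix.conjTranspose_mul, hX.eq, hY.eq, Matrix.trace_mul_comm]
  exact Complex.conj_eq_iff_im.1 h

theorem isHermitian_kronecker {ι : Type*} {X Y : Matrix ι ι ℂ} (hX : X.IsHermitian)
    (hY : Y.IsHermitian) : (X ⊗ₖ Y).IsHermitian := by
  rw [Matrix.IsHermitian, Matrix.conjTranspose_kronecker, hX.eq, hY.eq]

/-- The Hermitian part, as a real linear map. -/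
noncomputable def hermPart {ι : Type*} : Matrix ι ι ℂ →ₗ[ℝ] Matrix ι ι ℂ where
  toFun Z := (1 / 2 : ℂ) • (Z + Zᴴ)
  map_add' Z W := by
    ext a b
    simp
    ring
  map_smul' r Z := by
    ext a b
    simp
    ring

theorem isHermitian_hermPart {ι : Type*} (Z : Matrix ι ι ℂ) : (hermPart Z).IsHermitian := by
  ext a b
  simp [hermPart, add_comm]

theorem Matrix.IsHermitian.hermPart_eq {ι : Type*} {X : Matrix ι ι ℂ} (hX : X.IsHermitian) :
    hermPart X = X := by
  ext a b
  simp [hermPart, hX.eq]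
  ring

theorem eq_hermPart_add {ι : Type*} (Z : Matrix ι ι ℂ) :
    Z = hermPart Z + Complex.I • hermPart (-Complex.I • Z) := by
  ext a b
  simp only [hermPart, LinearMap.coe_mk, AddHom.coe_mk, Matrix.add_apply, Matrix.smul_apply,
    Matrix.conjTranspose_apply, smul_eq_mul, Complex.star_def, map_mul, map_neg, Complex.conj_I]
  linear_combination (1 / 2 * Z a b - 1 / 2 * (starRingEnd ℂ) (Z b a)) * Complex.I_sq

theorem hsSq_hermPart_le (Z : Matrix ι ι ℂ) : hsSq (hermPart Z) ≤ hsSq Z := by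
  have h : ∀ a b, ‖hermPart Z a b‖ ^ 2 ≤ (‖Z a b‖ ^ 2 + ‖Z b a‖ ^ 2) / 2 := by
    intro a b
    have h1 : ‖hermPart Z a b‖ ≤ (‖Z a b‖ + ‖Z b a‖) / 2 := by
      have := norm_add_le (Z a b) (star (Z b a))
      rw [norm_star] at this
      simp only [hermPart, LinearMap.coe_mk, AddHom.coe_mk, Matrix.smul_apply, Matrix.add_apply,
        Matrix.conjTranspose_apply, norm_smul]
      rw [show ‖(1 / 2 : ℂ)‖ = 1 / 2 by norm_num]
      linarith
    have h2 : ‖hermPart Z a b‖ ^ 2 ≤ ((‖Z a b‖ + ‖Z b a‖) / 2) ^ 2 := by gcongr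
    nlinarith [sq_nonneg (‖Z a b‖ - ‖Z b a‖)]
  refine (Finset.sum_le_sum fun a _ => Finset.sum_le_sum fun b _ => h a b).trans (le_of_eq ?_)
  simp only [← Finset.sum_div, Finset.sum_add_distrib]
  rw [Finset.sum_comm (f := fun a b => ‖Z b a‖ ^ 2), hsSq]
  ring

/-- An eigenvalue with unit eigenvector `v` equals `Re ⟪v, Z v⟫`. -/
theorem abs_eigenvalues_hermPart_le [DecidableEq ι] (Z : Matrix ι ι ℂ) (i : ι) :
    |(isHermitian_hermPart Z).eigenvalues i| ≤ opNorm Z := by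
  set v := (isHermitian_hermPart Z).eigenvectorBasis i with hv
  have hv1 : ‖v‖ = 1 := (isHermitian_hermPart Z).eigenvectorBasis.orthonormal.1 i
  have h1 : (isHermitian_hermPart Z).eigenvalues i =
      (inner ℂ v (Matrix.toEuclideanCLM (𝕜 := ℂ) Z v)).re := by
    have h2 : star (v : ι → ℂ) ⬝ᵥ (Zᴴ *ᵥ (v : ι → ℂ)) =
        star (star (v : ι → ℂ) ⬝ᵥ (Z *ᵥ (v : ι → ℂ))) := by
      rw [Matrix.star_dotProduct, Matrix.star_mulVec, Matrix.conjTranspose_conjTranspose,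
        ← Matrix.dotProduct_mulVec]
    have h3 : inner ℂ v (Matrix.toEuclideanCLM (𝕜 := ℂ) Z v) =
        star (v : ι → ℂ) ⬝ᵥ (Z *ᵥ (v : ι → ℂ)) := by
      rw [EuclideanSpace.inner_eq_star_dotProduct, dotProduct_comm]
      rfl
    have h4 : hermPart Z = (1 / 2 : ℂ) • (Z + Zᴴ) := rfl
    have h5 : star (v : ι → ℂ) ⬝ᵥ (hermPart Z *ᵥ (v : ι → ℂ)) =
        1 / 2 * (star (v : ι → ℂ) ⬝ᵥ (Z *ᵥ (v : ι → ℂ)) +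
          star (star (v : ι → ℂ) ⬝ᵥ (Z *ᵥ (v : ι → ℂ)))) := by
      rw [h4, Matrix.smul_mulVec, Matrix.add_mulVec, dotProduct_smul, dotProduct_add, h2,
        smul_eq_mul]
    rw [(isHermitian_hermPart Z).eigenvalues_eq, h3]
    refine (congrArg Complex.re h5).trans ?_
    simp
    ring
  rw [h1]
  refine (Complex.abs_re_le_norm _).trans ((norm_inner_le_norm _ _).trans ?_)
  rw [hv1, one_mul]
  refine ((Matrix.toEuclideanCLM (𝕜 := ℂ) Z).le_opNorm v).trans ?_
  rw [hv1, mul_one, opNorm]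

/-- The spectral component of a Hermitian matrix with eigenvalues replaced by `w`. -/
noncomputable def Matrix.IsHermitian.withEigenvalues [DecidableEq ι] {X : Matrix ι ι ℂ}
    (hX : X.IsHermitian) (w : ι → ℝ) : Matrix ι ι ℂ :=
  (hX.eigenvectorUnitary : Matrix ι ι ℂ) * Matrix.diagonal (fun a => (w a : ℂ)) *
    (hX.eigenvectorUnitary : Matrix ι ι ℂ)ᴴ

variable [DecidableEq ι] {X : Matrix ι ι ℂ} (hX : X.IsHermitian)

theorem Matrix.IsHermitian.withEigenvalues_eigenvalues :
    hX.withEigenvalues hX.eigenvalues = X := hX.eq_conj_diagonal.symm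

theorem Matrix.IsHermitian.withEigenvalues_add (w w' : ι → ℝ) :
    hX.withEigenvalues (w + w') = hX.withEigenvalues w + hX.withEigenvalues w' := by
  simp only [withEigenvalues, Pi.add_apply, Complex.ofReal_add]
  rw [← Matrix.diagonal_add, Matrix.mul_add, Matrix.add_mul]

theorem Matrix.IsHermitian.isHermitian_withEigenvalues (w : ι → ℝ) :
    (hX.withEigenvalues w).IsHermitian := by
  rw [Matrix.IsHermitian, withEigenvalues, Matrix.conjTranspose_mul, Matrix.conjTranspose_mul,
    Matrix.conjTranspose_conjTranspose, Matrix.diagonal_conjTranspose, Matrix.mul_assoc]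
  congr 3
  ext a
  simp

theorem Matrix.IsHermitian.hsSq_withEigenvalues (w : ι → ℝ) :
    hsSq (hX.withEigenvalues w) = ∑ a, w a ^ 2 := by
  have hU : (hX.eigenvectorUnitary : Matrix ι ι ℂ)ᴴ * hX.eigenvectorUnitary = 1 :=
    Matrix.mem_unitaryGroup_iff'.1 hX.eigenvectorUnitary.2
  have key : ∀ (U D : Matrix ι ι ℂ), Uᴴ * U = 1 →
      (U * D * Uᴴ * (U * D * Uᴴ)).trace = (D * D).trace := by
    intro U D h
    rw [Matrix.mul_assoc (U * D), ← Matrix.mul_assoc Uᴴ, ← Matrix.mul_assoc Uᴴ, h, Matrix.one_mul,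
      Matrix.trace_mul_comm, Matrix.mul_assoc, ← Matrix.mul_assoc Uᴴ, h, Matrix.one_mul]
  rw [← (hX.isHermitian_withEigenvalues w).hsSq_eq_trace, withEigenvalues, key _ _ hU,
    Matrix.diagonal_mul_diagonal, Matrix.trace_diagonal]
  simp [sq]

theorem Matrix.IsHermitian.opNorm_withEigenvalues_le (w : ι → ℝ) {δ : ℝ} (hδ : 0 ≤ δ)
    (hw : ∀ a, |w a| ≤ δ) : opNorm (hX.withEigenvalues w) ≤ δ := by
  have h1 : opNorm (hX.withEigenvalues w) =
      opNorm (Matrix.diagonal (fun a => (w a : ℂ))) := by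
    have hU1 := Matrix.mem_unitaryGroup_iff.1 hX.eigenvectorUnitary.2
    have hU2 := Matrix.mem_unitaryGroup_iff'.1 hX.eigenvectorUnitary.2
    have hV : Matrix.toEuclideanCLM (𝕜 := ℂ) (hX.eigenvectorUnitary : Matrix ι ι ℂ) ∈
        unitary (EuclideanSpace ℂ ι →L[ℂ] EuclideanSpace ℂ ι) := by
      rw [Unitary.mem_iff, ← map_star, ← map_mul, ← map_mul, hU1, hU2, map_one]
      exact ⟨rfl, rfl⟩
    have hV' := Unitary.star_mem hV
    rw [← map_star] at hV'
    rw [opNorm, opNorm, withEigenvalues, map_mul, map_mul]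
    have e1 := CStarRing.norm_mul_mem_unitary (Matrix.toEuclideanCLM (𝕜 := ℂ)
      (hX.eigenvectorUnitary : Matrix ι ι ℂ) * Matrix.toEuclideanCLM (𝕜 := ℂ)
        (Matrix.diagonal fun a => (w a : ℂ))) hV'
    have e2 := CStarRing.norm_mem_unitary_mul (Matrix.toEuclideanCLM (𝕜 := ℂ)
        (Matrix.diagonal fun a => (w a : ℂ))) hV
    exact e1.trans e2
  rw [h1, opNorm, Matrix.l2_opNorm_toEuclideanCLM, Matrix.l2_opNorm_diagonal,
    pi_norm_le_iff_of_nonneg hδ]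
  intro a
  simpa using hw a

theorem Matrix.IsHermitian.withEigenvalues_eq_sum (w : ι → ℝ) :
    hX.withEigenvalues w = ∑ a, (w a : ℂ) •
      symRankOne (hX.eigenvectorBasis a) (hX.eigenvectorBasis a) := by
  ext i j
  rw [withEigenvalues, Matrix.mul_apply, Matrix.sum_apply]
  refine Finset.sum_congr rfl fun a _ => ?_
  rw [Matrix.mul_diagonal, Matrix.conjTranspose_apply]
  simp only [symRankOne, Matrix.smul_apply, Matrix.of_apply, smul_eq_mul,
    Matrix.IsHermitian.eigenvectorUnitary_apply]
  ring

end Hermitian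

/-! ### The centred form on tensor products. -/

section KroneckerForm

open scoped Kronecker

variable {ι σ : Type*} [Fintype ι] [Fintype σ]

/-- The centred bilinear form `(X, Y) ↦ tr (R (X ⊗ Y)) - s tr X tr Y`. -/
noncomputable def kronForm (R : Matrix (ι × ι) (ι × ι) ℂ) (s : ℝ) :
    Matrix ι ι ℂ →ₗ[ℂ] Matrix ι ι ℂ →ₗ[ℂ] ℂ :=
  LinearMap.mk₂ ℂ (fun X Y => (R * (X ⊗ₖ Y)).trace - s * (X.trace * Y.trace))
    (fun X X' Y => by
      simp only [Matrix.add_kronecker, Matrix.mul_add, Matrix.trace_add]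
      ring)
    (fun c X Y => by
      simp only [Matrix.smul_kronecker, Matrix.mul_smul, Matrix.trace_smul, smul_eq_mul]
      ring)
    (fun X Y Y' => by
      simp only [Matrix.kronecker_add, Matrix.mul_add, Matrix.trace_add]
      ring)
    (fun c X Y => by
      simp only [Matrix.kronecker_smul, Matrix.mul_smul, Matrix.trace_smul, smul_eq_mul]
      ring)

theorem kronForm_apply (R : Matrix (ι × ι) (ι × ι) ℂ) (s : ℝ) (X Y : Matrix ι ι ℂ) :
    kronForm R s X Y = (R * (X ⊗ₖ Y)).trace - s * (X.trace * Y.trace) := rfl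

theorem kronForm_hermitian {R : Matrix (ι × ι) (ι × ι) ℂ} (hR : R.IsHermitian) (s : ℝ)
    {X Y : Matrix ι ι ℂ} (hX : X.IsHermitian) (hY : Y.IsHermitian) :
    kronForm R s X Y =
      (((R * (X ⊗ₖ Y)).trace.re - s * (X.trace.re * Y.trace.re) : ℝ) : ℂ) := by
  have h1 := hR.trace_mul_im (isHermitian_kronecker hX hY)
  have h2 := hX.trace_im
  have h3 := hY.trace_im
  rw [kronForm_apply]
  apply Complex.ext <;> simp [h1, h2, h3]

/-- The tensor product of two vectors. -/
noncomputable def tensorVec {ι : Type*} (u v : EuclideanSpace ℂ ι) : EuclideanSpace ℂ (ι × ι) :=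
  WithLp.toLp 2 fun p => u p.1 * v p.2

theorem norm_tensorVec (u v : EuclideanSpace ℂ ι) : ‖tensorVec u v‖ = ‖u‖ * ‖v‖ := by
  rw [← sq_eq_sq₀ (norm_nonneg _) (by positivity), mul_pow]
  simp only [EuclideanSpace.norm_sq_eq, tensorVec, Fintype.sum_prod_type, norm_mul, mul_pow,
    Finset.sum_mul_sum]

theorem symRankOne_kronecker {ι : Type*} (u v : EuclideanSpace ℂ ι) :
    symRankOne u u ⊗ₖ symRankOne v v = symRankOne (tensorVec u v) (tensorVec u v) := by
  ext ⟨i, j⟩ ⟨k, l⟩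
  simp [symRankOne, tensorVec]
  ring

/-- The real bilinear map `(u, v) ↦ Gᴴ (u ⊗ v)`. -/
noncomputable def adjointOnTensor (G : Matrix (ι × ι) σ ℂ) :
    EuclideanSpace ℂ ι →ₗ[ℝ] EuclideanSpace ℂ ι →ₗ[ℝ] EuclideanSpace ℂ σ :=
  LinearMap.mk₂ ℝ (fun u v => WithLp.toLp 2 (Gᴴ *ᵥ (tensorVec u v : ι × ι → ℂ)))
    (fun u u' v => by
      ext k
      simp [Matrix.mulVec, dotProduct, tensorVec, add_mul, mul_add, Finset.sum_add_distrib])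
    (fun c u v => by
      ext k
      simp only [Matrix.mulVec, dotProduct, tensorVec, PiLp.smul_apply, smul_mul_assoc,
        mul_smul_comm, Finset.smul_sum])
    (fun u v v' => by
      ext k
      simp [Matrix.mulVec, dotProduct, tensorVec, mul_add, Finset.sum_add_distrib])
    (fun c u v => by
      ext k
      simp only [Matrix.mulVec, dotProduct, tensorVec, PiLp.smul_apply,
        mul_smul_comm, Finset.smul_sum])

theorem norm_adjointOnTensor_sq (G : Matrix (ι × ι) σ ℂ) (u v : EuclideanSpace ℂ ι) :
    (G * Gᴴ * symRankOne (tensorVec u v) (tensorVec u v)).trace =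
      ((‖adjointOnTensor G u v‖ ^ 2 : ℝ) : ℂ) := by
  rw [trace_mul_symRankOne_self, ← Matrix.mulVec_mulVec, Matrix.dotProduct_mulVec]
  have h : star (tensorVec u v : ι × ι → ℂ) ᵥ* G =
      star (adjointOnTensor G u v : σ → ℂ) := by
    change _ = star (Gᴴ *ᵥ (tensorVec u v : ι × ι → ℂ))
    rw [Matrix.star_mulVec, Matrix.conjTranspose_conjTranspose]
  rw [h, EuclideanSpace.norm_sq_eq]
  change star (adjointOnTensor G u v : σ → ℂ) ⬝ᵥ (adjointOnTensor G u v : σ → ℂ) = _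
  simp [dotProduct, ← Complex.normSq_eq_conj_mul_self, Complex.normSq_eq_norm_sq]

theorem kronForm_symRankOne (G : Matrix (ι × ι) σ ℂ) (s : ℝ) (u v : EuclideanSpace ℂ ι) :
    kronForm (G * Gᴴ) s (symRankOne u u) (symRankOne v v) =
      ((‖adjointOnTensor G u v‖ ^ 2 - s * (‖u‖ ^ 2 * ‖v‖ ^ 2) : ℝ) : ℂ) := by
  rw [kronForm_hermitian (isHermitian_gram G) s (isHermitian_symRankOne u u)
    (isHermitian_symRankOne v v), symRankOne_kronecker, norm_adjointOnTensor_sq,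
    trace_symRankOne_self, trace_symRankOne_self, Complex.ofReal_re]

theorem norm_kronForm_symRankOne_le (G : Matrix (ι × ι) σ ℂ) {s T : ℝ} (hs : 0 ≤ s) (hsT : s ≤ T)
    {u v : EuclideanSpace ℂ ι} (hu : ‖u‖ ≤ 1) (hv : ‖v‖ ≤ 1)
    (h : ‖adjointOnTensor G u v‖ ^ 2 ≤ T) :
    ‖kronForm (G * Gᴴ) s (symRankOne u u) (symRankOne v v)‖ ≤ T := by
  rw [kronForm_symRankOne, Complex.norm_real, Real.norm_eq_abs, abs_le]
  have h1 : ‖u‖ ^ 2 * ‖v‖ ^ 2 ≤ 1 :=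
    mul_le_one₀ (pow_le_one₀ (norm_nonneg _) hu) (by positivity) (pow_le_one₀ (norm_nonneg _) hv)
  have h2 : s * (‖u‖ ^ 2 * ‖v‖ ^ 2) ≤ s * 1 := by gcongr
  have h3 : 0 ≤ s * (‖u‖ ^ 2 * ‖v‖ ^ 2) := by positivity
  have h4 := sq_nonneg ‖adjointOnTensor G u v‖
  constructor <;> linarith

variable [DecidableEq ι]

theorem norm_kronForm_withEigenvalues_le {R : Matrix (ι × ι) (ι × ι) ℂ} {s T K L : ℝ}
    (hT : ∀ u v : EuclideanSpace ℂ ι, ‖u‖ ≤ 1 → ‖v‖ ≤ 1 →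
      ‖kronForm R s (symRankOne u u) (symRankOne v v)‖ ≤ T) (hT0 : 0 ≤ T)
    {X Y : Matrix ι ι ℂ} (hX : X.IsHermitian) (hY : Y.IsHermitian) {w w' : ι → ℝ}
    (hw : ∑ a, |w a| ≤ K) (hw' : ∑ a, |w' a| ≤ L) :
    ‖kronForm R s (hX.withEigenvalues w) (hY.withEigenvalues w')‖ ≤ K * L * T := by
  rw [hX.withEigenvalues_eq_sum, hY.withEigenvalues_eq_sum]
  simp only [map_sum, map_smul, LinearMap.sum_apply, LinearMap.smul_apply]
  have hK : 0 ≤ K := (Finset.sum_nonneg fun a _ => abs_nonneg _).trans hw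
  have h1 : ∀ a b, ‖((w' b : ℂ) • (w a : ℂ) • kronForm R s
      (symRankOne (hX.eigenvectorBasis a) (hX.eigenvectorBasis a))
      (symRankOne (hY.eigenvectorBasis b) (hY.eigenvectorBasis b)))‖ ≤ |w a| * |w' b| * T := by
    intro a b
    rw [norm_smul, norm_smul, Complex.norm_real, Complex.norm_real, Real.norm_eq_abs,
      Real.norm_eq_abs, ← mul_assoc, mul_comm |w' b|]
    gcongr
    exact hT _ _ (hX.eigenvectorBasis.orthonormal.1 a).le (hY.eigenvectorBasis.orthonormal.1 b).le
  calc _ ≤ ∑ b, ∑ a, |w a| * |w' b| * T := by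
        refine (norm_sum_le _ _).trans (Finset.sum_le_sum fun b _ => ?_)
        rw [Finset.smul_sum]
        exact (norm_sum_le _ _).trans (Finset.sum_le_sum fun a _ => h1 a b)
    _ = (∑ a, |w a|) * (∑ b, |w' b|) * T := by
        rw [Finset.sum_comm, Finset.sum_mul_sum, Finset.sum_mul]
        simp only [Finset.sum_mul]
    _ ≤ K * L * T := by gcongr

/-- Splitting the eigenvalues at the level `δ` reduces a bound for the centred form to rank-one
arguments and to pairs of which one has small operator norm. -/
theorem norm_kronForm_le_of_split {R : Matrix (ι × ι) (ι × ι) ℂ} {s T T' δ : ℝ} (hδ : 0 < δ)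
    (hT : ∀ u v : EuclideanSpace ℂ ι, ‖u‖ ≤ 1 → ‖v‖ ≤ 1 →
      ‖kronForm R s (symRankOne u u) (symRankOne v v)‖ ≤ T) (hT0 : 0 ≤ T)
    (hT' : ∀ X Y : Matrix ι ι ℂ, X.IsHermitian → Y.IsHermitian → hsSq X ≤ 1 → hsSq Y ≤ 1 →
      (opNorm X ≤ δ ∨ opNorm Y ≤ δ) → ‖kronForm R s X Y‖ ≤ T')
    {X Y : Matrix ι ι ℂ} (hX : X.IsHermitian) (hY : Y.IsHermitian) (hX1 : hsSq X ≤ 1)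
    (hY1 : hsSq Y ≤ 1) : ‖kronForm R s X Y‖ ≤ δ⁻¹ * δ⁻¹ * T + 2 * T' := by
  let big : (ι → ℝ) → ι → ℝ := fun w a => if |w a| ≤ δ then 0 else w a
  let small : (ι → ℝ) → ι → ℝ := fun w a => if |w a| ≤ δ then w a else 0
  have hsplit : ∀ w, big w + small w = w := by
    intro w
    ext a
    by_cases h : |w a| ≤ δ <;> simp [big, small, h]
  have hsmall : ∀ w a, |small w a| ≤ δ := by
    intro w a
    by_cases h : |w a| ≤ δ <;> simp [small, h, hδ.le]
  have hsmallsq : ∀ w, ∑ a, small w a ^ 2 ≤ ∑ a, w a ^ 2 := by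
    intro w
    refine Finset.sum_le_sum fun a _ => ?_
    by_cases h : |w a| ≤ δ <;> simp [small, h, sq_nonneg]
  have hbigsq : ∀ w, ∑ a, big w a ^ 2 ≤ ∑ a, w a ^ 2 := by
    intro w
    refine Finset.sum_le_sum fun a _ => ?_
    by_cases h : |w a| ≤ δ <;> simp [big, h, sq_nonneg]
  have hbig : ∀ w, ∑ a, w a ^ 2 ≤ 1 → ∑ a, |big w a| ≤ δ⁻¹ := by
    intro w hw
    -- An eigenvalue with `|w a| > δ` satisfies `|w a| ≤ w a² / δ`, so a Hilbert–Schmidt bound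
    -- becomes a trace-norm bound.
    have h1 : ∀ a, |big w a| ≤ δ⁻¹ * w a ^ 2 := by
      intro a
      by_cases h : |w a| ≤ δ
      · simp only [big, h, if_true, abs_zero]
        positivity
      · simp only [big, h, if_false]
        rw [← sq_abs, le_inv_mul_iff₀ hδ]
        nlinarith [abs_nonneg (w a)]
    refine (Finset.sum_le_sum fun a _ => h1 a).trans ?_
    rw [← Finset.mul_sum]
    exact mul_le_of_le_one_right (by positivity) hw
  have eX : X = hX.withEigenvalues (big hX.eigenvalues) +
      hX.withEigenvalues (small hX.eigenvalues) := by
    rw [← hX.withEigenvalues_add, hsplit, hX.withEigenvalues_eigenvalues]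
  have eY : Y = hY.withEigenvalues (big hY.eigenvalues) +
      hY.withEigenvalues (small hY.eigenvalues) := by
    rw [← hY.withEigenvalues_add, hsplit, hY.withEigenvalues_eigenvalues]
  have hXs := hX1
  have hYs := hY1
  rw [← hX.sum_eigenvalues_sq_eq_hsSq] at hXs
  rw [← hY.sum_eigenvalues_sq_eq_hsSq] at hYs
  have b1 := norm_kronForm_withEigenvalues_le hT hT0 hX hY (hbig _ hXs) (hbig _ hYs)
  have b2 := hT' (hX.withEigenvalues (small hX.eigenvalues)) Y
    (hX.isHermitian_withEigenvalues _) hY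
    (by rw [hX.hsSq_withEigenvalues]; exact (hsmallsq _).trans hXs) hY1
    (Or.inl (hX.opNorm_withEigenvalues_le _ hδ.le (hsmall _)))
  have b3 := hT' (hX.withEigenvalues (big hX.eigenvalues))
    (hY.withEigenvalues (small hY.eigenvalues))
    (hX.isHermitian_withEigenvalues _) (hY.isHermitian_withEigenvalues _)
    (by rw [hX.hsSq_withEigenvalues]; exact (hbigsq _).trans hXs)
    (by rw [hY.hsSq_withEigenvalues]; exact (hsmallsq _).trans hYs)
    (Or.inr (hY.opNorm_withEigenvalues_le _ hδ.le (hsmall _)))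
  -- Keeping `Y` whole next to the small part of `X` leaves three terms instead of four.
  have e : kronForm R s X Y =
      kronForm R s (hX.withEigenvalues (big hX.eigenvalues))
        (hY.withEigenvalues (big hY.eigenvalues)) +
      kronForm R s (hX.withEigenvalues (small hX.eigenvalues)) Y +
      kronForm R s (hX.withEigenvalues (big hX.eigenvalues))
        (hY.withEigenvalues (small hY.eigenvalues)) := by
    conv_lhs => rw [eX, map_add, LinearMap.add_apply]
    conv_lhs =>
      arg 1
      rw [eY, map_add]
    ring
  rw [e]
  refine norm_add₃_le.trans ?_
  linarith

/-- Passing from Hermitian to arbitrary arguments costs a factor of four. -/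
theorem norm_kronForm_le_four_mul {ι : Type*} [Fintype ι] {R : Matrix (ι × ι) (ι × ι) ℂ} {s T : ℝ}
    (hT : ∀ X Y : Matrix ι ι ℂ, X.IsHermitian → Y.IsHermitian → hsSq X ≤ 1 → hsSq Y ≤ 1 →
      ‖kronForm R s X Y‖ ≤ T) {X Y : Matrix ι ι ℂ} (hX : hsSq X ≤ 1) (hY : hsSq Y ≤ 1) :
    ‖kronForm R s X Y‖ ≤ 4 * T := by
  have hI : ∀ Z : Matrix ι ι ℂ, hsSq (-Complex.I • Z) = hsSq Z := by
    intro Z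
    simp [hsSq]
  have h1 : ∀ Z : Matrix ι ι ℂ, hsSq Z ≤ 1 → hsSq (hermPart Z) ≤ 1 := fun Z hZ =>
    (hsSq_hermPart_le Z).trans hZ
  have h2 : ∀ Z : Matrix ι ι ℂ, hsSq Z ≤ 1 → hsSq (hermPart (-Complex.I • Z)) ≤ 1 := fun Z hZ =>
    (hsSq_hermPart_le _).trans (by rwa [hI])
  have hh := fun Z : Matrix ι ι ℂ => isHermitian_hermPart Z
  have e : kronForm R s X Y = kronForm R s (hermPart X) (hermPart Y) +
      Complex.I * kronForm R s (hermPart X) (hermPart (-Complex.I • Y)) +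
      Complex.I * kronForm R s (hermPart (-Complex.I • X)) (hermPart Y) +
      Complex.I * (Complex.I *
        kronForm R s (hermPart (-Complex.I • X)) (hermPart (-Complex.I • Y))) := by
    conv_lhs => rw [eq_hermPart_add X, eq_hermPart_add Y]
    simp only [map_add, map_smul, LinearMap.add_apply, LinearMap.smul_apply, smul_eq_mul]
    ring
  rw [e]
  have a1 := hT _ _ (hh X) (hh Y) (h1 X hX) (h1 Y hY)
  have a2 := hT _ _ (hh X) (hh (-Complex.I • Y)) (h1 X hX) (h2 Y hY)
  have a3 := hT _ _ (hh (-Complex.I • X)) (hh Y) (h2 X hX) (h1 Y hY)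
  have a4 := hT _ _ (hh (-Complex.I • X)) (hh (-Complex.I • Y)) (h2 X hX) (h2 Y hY)
  refine (norm_add₄_le).trans ?_
  simp only [norm_mul, Complex.norm_I, one_mul]
  linarith

end KroneckerForm

/-! ### Small environment: the dual witness `ρ - 1/d²`. -/

section SmallEnvironment

open scoped Kronecker

theorem exists_eq_norm_smul {V : Type*} [NormedAddCommGroup V] [NormedSpace ℂ V] (x : V) :
    ∃ x' : V, ‖x'‖ ≤ 1 ∧ (‖x‖ : ℂ) • x' = x := by
  by_cases hx : x = 0
  · exact ⟨0, by simp, by simp [hx]⟩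
  · have hx' : ‖x‖ ≠ 0 := norm_ne_zero_iff.2 hx
    refine ⟨(‖x‖ : ℂ)⁻¹ • x, by simp [norm_smul, hx'], ?_⟩
    rw [smul_smul, mul_inv_cancel₀ (by exact_mod_cast hx'), one_smul]

theorem opBound_of_unit {m n : Type*} [Fintype m] [Fintype n] {B : Matrix m n ℂ} {κ : ℝ}
    (h : ∀ (x : EuclideanSpace ℂ m) (y : EuclideanSpace ℂ n), ‖x‖ ≤ 1 → ‖y‖ ≤ 1 →
      ‖∑ i, ∑ j, star (x i) * B i j * y j‖ ≤ κ) : OpBound B κ := by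
  intro x y
  have hsmul : ∀ (a b : ℂ) (x : EuclideanSpace ℂ m) (y : EuclideanSpace ℂ n),
      ∑ i, ∑ j, star ((a • x) i) * B i j * (b • y) j =
        star a * b * ∑ i, ∑ j, star (x i) * B i j * y j := by
    intro a b x y
    rw [Finset.mul_sum]
    refine Finset.sum_congr rfl fun i _ => ?_
    rw [Finset.mul_sum]
    refine Finset.sum_congr rfl fun j _ => ?_
    simp only [PiLp.smul_apply, smul_eq_mul, star_mul']
    ring
  obtain ⟨x', hx', hx⟩ := exists_eq_norm_smul x
  obtain ⟨y', hy', hy⟩ := exists_eq_norm_smul y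
  have h1 := hsmul ‖x‖ ‖y‖ x' y'
  rw [hx, hy] at h1
  rw [h1, norm_mul, norm_mul, norm_star, Complex.norm_real, Complex.norm_real, norm_norm, norm_norm]
  have h2 := h x' y' hx' hy'
  have h3 : ‖x‖ * ‖y‖ * ‖∑ i, ∑ j, star (x' i) * B i j * y' j‖ ≤ ‖x‖ * ‖y‖ * κ := by gcongr
  linarith

variable {ι σ : Type*} [Fintype ι] [Fintype σ] [DecidableEq ι]

/-- Reshaping the vectors into matrices turns the operator norm of a realignment into a supremum
over Hilbert–Schmidt balls. -/
theorem trace_mul_kronecker_eq_sum {ι : Type*} [Fintype ι] (C : Matrix (ι × ι) (ι × ι) ℂ)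
    (x y : EuclideanSpace ℂ (ι × ι)) :
    ∑ p, ∑ q, star (x p) * realign C p q * y q =
      (C * ((Matrix.of fun k i => star (x (i, k))) ⊗ₖ (Matrix.of fun l j => y (j, l)))).trace := by
  simp only [Matrix.trace, Matrix.diag_apply, Matrix.mul_apply, Fintype.sum_prod_type, realign,
    Matrix.of_apply, Matrix.kroneckerMap_apply]
  refine Finset.sum_congr rfl fun i _ => ?_
  rw [Finset.sum_comm]
  refine Finset.sum_congr rfl fun j _ => Finset.sum_congr rfl fun k _ =>
    Finset.sum_congr rfl fun l _ => by ring

theorem norm_trace_sq_le {ι : Type*} [Fintype ι] (X : Matrix ι ι ℂ) : ‖X.trace‖ ^ 2 ≤ Fintype.card ι * hsSq X := by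
  have h1 : ‖X.trace‖ ≤ ∑ a, ‖X a a‖ := norm_sum_le _ _
  have h2 : (∑ a, ‖X a a‖) ^ 2 ≤ Fintype.card ι * ∑ a, ‖X a a‖ ^ 2 := by
    simpa using sq_sum_le_card_mul_sum_sq (s := Finset.univ) (f := fun a => ‖X a a‖)
  have h3 : ∑ a, ‖X a a‖ ^ 2 ≤ hsSq X := Finset.sum_le_sum fun a _ =>
    Finset.single_le_sum (f := fun b => ‖X a b‖ ^ 2) (fun _ _ => sq_nonneg _) (Finset.mem_univ a)
  calc ‖X.trace‖ ^ 2 ≤ (∑ a, ‖X a a‖) ^ 2 := by gcongr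
    _ ≤ _ := h2.trans (by gcongr)

/-- Test the form on `X = Y = 1 / √d`, of Hilbert–Schmidt norm 1. -/
theorem abs_trace_sub_le [Nonempty ι] {R : Matrix (ι × ι) (ι × ι) ℂ} {s T N : ℝ}
    (hN : R.trace = N)
    (hT : ∀ X Y : Matrix ι ι ℂ, X.IsHermitian → Y.IsHermitian → hsSq X ≤ 1 → hsSq Y ≤ 1 →
      ‖kronForm R s X Y‖ ≤ T) :
    |N - s * (Fintype.card ι : ℝ) ^ 2| ≤ Fintype.card ι * T := by
  set d : ℝ := (Fintype.card ι : ℝ) with hd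
  have hd0 : 0 < d := by rw [hd]; exact_mod_cast Fintype.card_pos
  let X : Matrix ι ι ℂ := (((√d)⁻¹ : ℝ) : ℂ) • 1
  have hX : X.IsHermitian := by
    ext a b
    by_cases hab : a = b
    · simp [X, hab]
    · simp [X, hab, Ne.symm hab]
  have hX1 : hsSq X ≤ 1 := by
    rw [← hX.hsSq_eq_trace]
    simp only [X, Matrix.smul_mul, Matrix.mul_smul, Matrix.one_mul, Matrix.trace_smul,
      Matrix.trace_one, smul_eq_mul]
    rw [← Complex.ofReal_natCast, ← hd, ← Complex.ofReal_mul, ← Complex.ofReal_mul,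
      Complex.ofReal_re, ← mul_assoc, ← mul_inv, Real.mul_self_sqrt hd0.le, inv_mul_cancel₀ hd0.ne']
  have h := hT X X hX hX hX1 hX1
  have e : kronForm R s X X = ((d⁻¹ * (N - s * d ^ 2) : ℝ) : ℂ) := by
    have h1 : kronForm R s 1 1 = ((N - s * d ^ 2 : ℝ) : ℂ) := by
      rw [kronForm_apply, Matrix.one_kronecker_one, Matrix.mul_one, hN, Matrix.trace_one, hd]
      push_cast
      ring
    simp only [X, map_smul, LinearMap.smul_apply, smul_eq_mul, h1]
    rw [← Complex.ofReal_mul, ← Complex.ofReal_mul, ← mul_assoc, ← mul_inv,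
      Real.mul_self_sqrt hd0.le]
  rw [e, Complex.norm_real, Real.norm_eq_abs, abs_mul, abs_of_pos (inv_pos.2 hd0),
    inv_mul_le_iff₀ hd0] at h
  exact h

/-- The form contributes `4 T` on general arguments, and replacing `s` by `N / d²` contributes
another `T` because `|tr X tr Y| ≤ d`. Then `5 T / N ≤ (d² / 8) / (d² s / 2) = 1 / (4 s)`. -/
theorem opBound_realign [Nonempty ι] {R : Matrix (ι × ι) (ι × ι) ℂ} {s T N : ℝ} (hs : 0 < s)
    (hN : R.trace = N) (hN' : (Fintype.card ι : ℝ) ^ 2 * s / 2 ≤ N)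
    (hT : ∀ X Y : Matrix ι ι ℂ, X.IsHermitian → Y.IsHermitian → hsSq X ≤ 1 → hsSq Y ≤ 1 →
      ‖kronForm R s X Y‖ ≤ T) (hTd : T ≤ (Fintype.card ι : ℝ) ^ 2 / 40) :
    OpBound (realign ((N : ℂ)⁻¹ • R -
      ((Fintype.card ι : ℂ) ^ 2)⁻¹ • (1 : Matrix (ι × ι) (ι × ι) ℂ))) (1 / (4 * s)) := by
  have hNs := abs_trace_sub_le hN hT
  rw [← Complex.ofReal_natCast]
  set d : ℝ := (Fintype.card ι : ℝ) with hd
  have hd0 : 0 < d := by rw [hd]; exact_mod_cast Fintype.card_pos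
  have hN0 : 0 < N := lt_of_lt_of_le (by positivity) hN'
  refine opBound_of_unit fun x y hx hy => ?_
  rw [trace_mul_kronecker_eq_sum]
  set X : Matrix ι ι ℂ := Matrix.of fun k i => star (x (i, k)) with hX
  set Y : Matrix ι ι ℂ := Matrix.of fun l j => y (j, l) with hY
  have hX1 : hsSq X ≤ 1 := by
    have : hsSq X = ‖x‖ ^ 2 := by
      rw [EuclideanSpace.norm_sq_eq, Fintype.sum_prod_type_right]
      simp [hsSq, hX]
    rw [this]
    exact pow_le_one₀ (norm_nonneg _) hx
  have hY1 : hsSq Y ≤ 1 := by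
    have : hsSq Y = ‖y‖ ^ 2 := by
      rw [EuclideanSpace.norm_sq_eq, Fintype.sum_prod_type_right]
      simp [hsSq, hY]
    rw [this]
    exact pow_le_one₀ (norm_nonneg _) hy
  have hk := norm_kronForm_le_four_mul hT hX1 hY1
  have htr : ‖X.trace * Y.trace‖ ≤ d := by
    rw [norm_mul]
    have h1 := norm_trace_sq_le X
    have h2 := norm_trace_sq_le Y
    rw [← hd] at h1 h2
    nlinarith [sq_nonneg (‖X.trace‖ - ‖Y.trace‖)]
  have e : (((N : ℂ)⁻¹ • R - ((d : ℂ) ^ 2)⁻¹ • (1 : Matrix (ι × ι) (ι × ι) ℂ)) * (X ⊗ₖ Y)).trace =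
      ((N⁻¹ : ℝ) : ℂ) * (kronForm R s X Y -
        ((d⁻¹ ^ 2 * (N - s * d ^ 2) : ℝ) : ℂ) * (X.trace * Y.trace)) := by
    rw [Matrix.sub_mul, Matrix.trace_sub, Matrix.smul_mul, Matrix.smul_mul, Matrix.one_mul,
      Matrix.trace_smul, Matrix.trace_smul, Matrix.trace_kronecker, kronForm_apply]
    have hNc : (N : ℂ) ≠ 0 := by exact_mod_cast hN0.ne'
    have hdc : (d : ℂ) ≠ 0 := by exact_mod_cast hd0.ne'
    simp only [smul_eq_mul]
    push_cast
    field_simp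
    ring
  have hT0 : 0 ≤ T := by
    have := (abs_nonneg _).trans hNs
    exact nonneg_of_mul_nonneg_right this hd0
  rw [e, norm_mul, Complex.norm_real, Real.norm_eq_abs, abs_of_pos (inv_pos.2 hN0)]
  have h1 : ‖kronForm R s X Y - ((d⁻¹ ^ 2 * (N - s * d ^ 2) : ℝ) : ℂ) * (X.trace * Y.trace)‖ ≤
      5 * T := by
    refine (norm_sub_le _ _).trans ?_
    rw [norm_mul (((d⁻¹ ^ 2 * (N - s * d ^ 2) : ℝ) : ℂ)), Complex.norm_real, Real.norm_eq_abs,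
      abs_mul, abs_of_pos (show 0 < d⁻¹ ^ 2 by positivity)]
    have h2 : d⁻¹ ^ 2 * |N - s * d ^ 2| * ‖X.trace * Y.trace‖ ≤ d⁻¹ ^ 2 * (d * T) * d := by
      gcongr
    have h3 : d⁻¹ ^ 2 * (d * T) * d = T := by field_simp
    linarith
  calc N⁻¹ * _ ≤ N⁻¹ * (5 * T) := by gcongr
    _ ≤ 1 / (4 * s) := by
      rw [inv_mul_le_iff₀ hN0]
      have h4 : d ^ 2 * s / 2 * (1 / (4 * s)) ≤ N * (1 / (4 * s)) := by gcongr
      have h5 : d ^ 2 * s / 2 * (1 / (4 * s)) = d ^ 2 / 8 := by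
        field_simp
        norm_num
      linarith

/-- The purity equals that of the `s × s` matrix `Aᴴ A` of trace 1, to which Cauchy–Schwarz applies.
-/
theorem inv_card_le_purity {n : Type*} [Fintype n] [Nonempty σ] (A : Matrix n σ ℂ)
    (hA : (A * Aᴴ).trace = 1) :
    1 / (Fintype.card σ : ℝ) ≤ ((A * Aᴴ) * (A * Aᴴ)).trace.re := by
  have hs : (0 : ℝ) < Fintype.card σ := by exact_mod_cast Fintype.card_pos
  have hH : (Aᴴ * A).IsHermitian := Matrix.isHermitian_conjTranspose_mul_self A
  have h1 : ((A * Aᴴ) * (A * Aᴴ)).trace = ((Aᴴ * A) * (Aᴴ * A)).trace := by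
    rw [Matrix.mul_assoc, Matrix.trace_mul_comm, Matrix.mul_assoc, Matrix.mul_assoc,
      Matrix.mul_assoc]
  rw [h1, hH.hsSq_eq_trace, div_le_iff₀ hs, mul_comm]
  have h2 := norm_trace_sq_le (Aᴴ * A)
  rw [Matrix.trace_mul_comm, hA] at h2
  simpa using h2

theorem two_mul_le_re_trace [Nonempty σ] (A : Matrix (ι × ι) σ ℂ) (hA : (A * Aᴴ).trace = 1)
    (hs : 2 * (Fintype.card σ : ℝ) ≤ (Fintype.card ι : ℝ) ^ 2) :
    2 * (1 / (4 * (Fintype.card σ : ℝ))) ≤ ((A * Aᴴ)ᴴ * (A * Aᴴ -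
      ((Fintype.card ι : ℂ) ^ 2)⁻¹ • (1 : Matrix (ι × ι) (ι × ι) ℂ))).trace.re := by
  have h1 := inv_card_le_purity A hA
  have hs0 : (0 : ℝ) < Fintype.card σ := by exact_mod_cast Fintype.card_pos
  rw [(isHermitian_gram A).eq, Matrix.mul_sub, Matrix.trace_sub, Complex.sub_re, Matrix.mul_smul,
    Matrix.mul_one, Matrix.trace_smul, hA]
  have h2 : (((Fintype.card ι : ℂ) ^ 2)⁻¹ • (1 : ℂ)).re = 1 / (Fintype.card ι : ℝ) ^ 2 := by
    rw [← Complex.ofReal_natCast, ← Complex.ofReal_pow, ← Complex.ofReal_inv, smul_eq_mul, mul_one,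
      Complex.ofReal_re, one_div]
  rw [h2]
  have h3 : 1 / (Fintype.card ι : ℝ) ^ 2 ≤ 1 / (2 * Fintype.card σ) := by gcongr
  have h4 : 2 * (1 / (4 * (Fintype.card σ : ℝ))) = 1 / Fintype.card σ - 1 / (2 * Fintype.card σ) := by
    field_simp
    norm_num
  linarith

end SmallEnvironment

/-! ### Nets and exceptional events for the centred form. -/

section Entangled

open scoped Kronecker

/-- The entries of a square matrix, as a vector of a Euclidean space. -/
noncomputable def vecMap (ι : Type*) [Fintype ι] :
    Matrix ι ι ℂ →ₗ[ℝ] EuclideanSpace ℂ (ι × ι) where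
  toFun Z := WithLp.toLp 2 fun p => Z p.1 p.2
  map_add' _ _ := rfl
  map_smul' _ _ := rfl

theorem norm_vecMap_le_one_iff {ι : Type*} [Fintype ι] (Z : Matrix ι ι ℂ) :
    ‖vecMap ι Z‖ ≤ 1 ↔ hsSq Z ≤ 1 := by
  have h : ‖vecMap ι Z‖ ^ 2 = hsSq Z := by
    rw [EuclideanSpace.norm_sq_eq, Fintype.sum_prod_type]
    rfl
  rw [← h, pow_le_one_iff_of_nonneg (norm_nonneg _) two_ne_zero]

theorem vecMap_injective (ι : Type*) [Fintype ι] : Function.Injective (vecMap ι) := by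
  intro Z W h
  ext a b
  exact congrArg (fun v : EuclideanSpace ℂ (ι × ι) => v (a, b)) h

variable {ι σ : Type*} [Fintype ι] [DecidableEq ι] [Fintype σ]

/-- The map whose norm is the maximum of the Hilbert–Schmidt norm and of the operator norm
divided by `δ`. -/
noncomputable def truncMap (ι : Type*) [Fintype ι] [DecidableEq ι] (δ : ℝ) : Matrix ι ι ℂ →ₗ[ℝ]
    EuclideanSpace ℂ (ι × ι) × (EuclideanSpace ℂ ι →L[ℂ] EuclideanSpace ℂ ι) :=
  (vecMap ι).prod (δ⁻¹ • ((Matrix.toEuclideanCLM (𝕜 := ℂ) (n := ι)).toAlgEquiv.toLinearMap.restrictScalars ℝ))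

theorem norm_truncMap_le_one_iff {δ : ℝ} (hδ : 0 < δ) (Z : Matrix ι ι ℂ) :
    ‖truncMap ι δ Z‖ ≤ 1 ↔ hsSq Z ≤ 1 ∧ opNorm Z ≤ δ := by
  have h : truncMap ι δ Z = (vecMap ι Z, δ⁻¹ • Matrix.toEuclideanCLM (𝕜 := ℂ) Z) := rfl
  rw [h, Prod.norm_mk, max_le_iff, norm_vecMap_le_one_iff, norm_smul, Real.norm_eq_abs,
    abs_of_pos (inv_pos.2 hδ), inv_mul_le_iff₀ hδ, mul_one]
  rfl

theorem truncMap_injective (δ : ℝ) : Function.Injective (truncMap ι δ) := fun _ _ h =>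
  vecMap_injective ι (congrArg Prod.fst h)

/-- The centred form on Hermitian parts, as a real bilinear map. -/
noncomputable def hermForm {ι : Type*} [Fintype ι] (R : Matrix (ι × ι) (ι × ι) ℂ) (s : ℝ) :
    Matrix ι ι ℂ →ₗ[ℝ] Matrix ι ι ℂ →ₗ[ℝ] ℂ :=
  LinearMap.mk₂ ℝ (fun Z W => kronForm R s (hermPart Z) (hermPart W))
    (fun Z Z' W => by simp)
    (fun c Z W => by
      rw [map_smul, ← Complex.coe_smul, map_smul, LinearMap.smul_apply, Complex.coe_smul])
    (fun Z W W' => by simp)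
    (fun c Z W => by
      rw [map_smul, ← Complex.coe_smul, map_smul, Complex.coe_smul])

theorem hermForm_apply {ι : Type*} [Fintype ι] (R : Matrix (ι × ι) (ι × ι) ℂ) (s : ℝ)
    (Z W : Matrix ι ι ℂ) : hermForm R s Z W = kronForm R s (hermPart Z) (hermPart W) := rfl

/-- The event that the centred form is at least `t` on the Hermitian parts of `Z` and `W`. -/
def kronEvent {ι : Type*} [Fintype ι] (σ : Type*) [Fintype σ] (t : ℝ) (Z W : Matrix ι ι ℂ) :
    Set (EuclideanSpace ℂ ((ι × ι) × σ)) :=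
  {z | t ≤ |(coeffMatrix z * (coeffMatrix z)ᴴ * (hermPart Z ⊗ₖ hermPart W)).trace.re -
    Fintype.card σ * ((hermPart Z).trace.re * (hermPart W).trace.re)|}

theorem abs_eigenvalues_le_one {X : Matrix ι ι ℂ} (hX : X.IsHermitian) (h : hsSq X ≤ 1) (i : ι) :
    |hX.eigenvalues i| ≤ 1 := by
  have h1 : hX.eigenvalues i ^ 2 ≤ ∑ a, hX.eigenvalues a ^ 2 :=
    Finset.single_le_sum (f := fun a => hX.eigenvalues a ^ 2) (fun _ _ => sq_nonneg _)
      (Finset.mem_univ i)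
  rw [hX.sum_eigenvalues_sq_eq_hsSq] at h1
  rw [← sq_le_one_iff_abs_le_one]
  linarith

/-- Net points need not be Hermitian: taking Hermitian parts increases neither the Hilbert–Schmidt
norm nor the bound on the eigenvalues by the operator norm. -/
theorem gaussianOn_kronEvent_le {Z W : Matrix ι ι ℂ} {τ δ : ℝ} (hτ : 0 < τ) (hτδ : τ * δ ≤ 1 / 2)
    (hZ : hsSq Z ≤ 1) (hW : hsSq W ≤ 1) (h : opNorm Z ≤ δ ∨ opNorm W ≤ δ) (t : ℝ) :
    gaussianOn (EuclideanSpace ℂ ((ι × ι) × σ)) (kronEvent σ t Z W) ≤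
      ENNReal.ofReal (2 * Real.exp (-(τ * t) + τ ^ 2 * Fintype.card σ)) := by
  have hZ' := (hsSq_hermPart_le Z).trans hZ
  have hW' := (hsSq_hermPart_le W).trans hW
  have hZt := hZ'
  have hWt := hW'
  rw [← (isHermitian_hermPart Z).hsSq_eq_trace] at hZt
  rw [← (isHermitian_hermPart W).hsSq_eq_trace] at hWt
  rcases h with h | h
  · exact gaussianOn_kronecker_tail (isHermitian_hermPart Z) (isHermitian_hermPart W) hτ
      (fun a => (abs_eigenvalues_hermPart_le Z a).trans h) (abs_eigenvalues_le_one _ hW')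
      (by rwa [mul_one]) hZt hWt t
  · exact gaussianOn_kronecker_tail (isHermitian_hermPart Z) (isHermitian_hermPart W) hτ
      (abs_eigenvalues_le_one _ hZ') (fun a => (abs_eigenvalues_hermPart_le W a).trans h)
      (by rwa [one_mul]) hZt hWt t

theorem norm_hermForm_le_of_notMem {ι σ : Type*} [Fintype ι] [Fintype σ]
    {z : EuclideanSpace ℂ ((ι × ι) × σ)} {t : ℝ}
    {Z W : Matrix ι ι ℂ} (h : z ∉ kronEvent σ t Z W) :
    ‖hermForm (coeffMatrix z * (coeffMatrix z)ᴴ) (Fintype.card σ) Z W‖ ≤ t := by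
  rw [hermForm_apply, kronForm_hermitian (isHermitian_gram _) _ (isHermitian_hermPart Z)
    (isHermitian_hermPart W), Complex.norm_real, Real.norm_eq_abs]
  exact (not_le.1 h).le

/-- The event that `‖Gᴴ (u ⊗ v)‖²` deviates by at least `t` from its mean. -/
def rankOneEvent {ι : Type*} [Fintype ι] (σ : Type*) [Fintype σ] (t : ℝ) (u v : EuclideanSpace ℂ ι) :
    Set (EuclideanSpace ℂ ((ι × ι) × σ)) :=
  {z | t ≤ |(coeffMatrix z * (coeffMatrix z)ᴴ *
    symRankOne (tensorVec u v) (tensorVec u v)).trace.re -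
      Fintype.card σ * (symRankOne (tensorVec u v) (tensorVec u v)).trace.re|}

theorem gaussianOn_rankOneEvent_le {u v : EuclideanSpace ℂ ι} (hu : ‖u‖ ≤ 1) (hv : ‖v‖ ≤ 1)
    (t : ℝ) : gaussianOn (EuclideanSpace ℂ ((ι × ι) × σ)) (rankOneEvent σ t u v) ≤
      ENNReal.ofReal (2 * Real.exp (-(1 / 2 * t) + (1 / 2) ^ 2 * Fintype.card σ)) := by
  have h : ‖tensorVec u v‖ ≤ 1 := by
    rw [norm_tensorVec]
    exact mul_le_one₀ hu (norm_nonneg _) hv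
  exact gaussianOn_unit_tail (isHermitian_symRankOne _ _) (by norm_num) le_rfl
    (trace_symRankOne_sq_le _ _ h h) t

theorem norm_adjointOnTensor_sq_le_of_notMem {ι σ : Type*} [Fintype ι] [Fintype σ]
    {z : EuclideanSpace ℂ ((ι × ι) × σ)} {t : ℝ}
    {u v : EuclideanSpace ℂ ι} (hu : ‖u‖ ≤ 1) (hv : ‖v‖ ≤ 1) (h : z ∉ rankOneEvent σ t u v) :
    ‖adjointOnTensor (coeffMatrix z) u v‖ ^ 2 ≤ t + Fintype.card σ := by
  rw [rankOneEvent, Set.mem_ofPred_eq, not_le] at h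
  have h1 := (abs_lt.1 h).2.le
  rw [norm_adjointOnTensor_sq, Complex.ofReal_re, trace_symRankOne_self, norm_tensorVec] at h1
  have h2 : (Fintype.card σ : ℝ) * (‖u‖ * ‖v‖) ^ 2 ≤ Fintype.card σ * 1 := by
    gcongr
    exact pow_le_one₀ (by positivity) (mul_le_one₀ hu (norm_nonneg _) hv)
  linarith

/-- The event that `‖z‖²` is at most half its mean. -/
def smallNormEvent (n σ : Type*) [Fintype n] [Fintype σ] : Set (EuclideanSpace ℂ (n × σ)) :=
  {z | ‖z‖ ^ 2 ≤ Fintype.card n * Fintype.card σ / 2}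

theorem gaussianOn_smallNormEvent_le (n σ : Type*) [Fintype n] [Fintype σ] :
    gaussianOn (EuclideanSpace ℂ (n × σ)) (smallNormEvent n σ) ≤
      ENNReal.ofReal (2 * Real.exp (-(Fintype.card n * Fintype.card σ / 16))) := by
  classical
  have h := gaussianOn_trace_tail (σ := σ) (Submonoid.one_mem (Matrix.unitaryGroup n ℂ))
    (fun _ => 1) (τ := 1 / 4) (v := Fintype.card n) (by norm_num) (by norm_num) (by simp)
    (Fintype.card n * Fintype.card σ / 2)
  refine (measure_mono fun z hz => ?_).trans (h.trans (ENNReal.ofReal_le_ofReal ?_))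
  · simp only [smallNormEvent, Set.mem_ofPred_eq] at hz ⊢
    have h1 : (1 : Matrix n n ℂ) * Matrix.diagonal (fun _ => ((1 : ℝ) : ℂ)) * (1 : Matrix n n ℂ)ᴴ =
        1 := by simp
    rw [h1, Matrix.mul_one, trace_mul_conjTranspose_eq_norm_sq, Complex.ofReal_re]
    refine le_trans ?_ (neg_le_abs _)
    simp only [Finset.sum_const, Finset.card_univ, nsmul_eq_mul, mul_one]
    linarith [mul_comm (Fintype.card n : ℝ) (Fintype.card σ)]
  · gcongr
    linarith

end Entangled

/-! ### The entangled regime and the final constants. -/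

section Main

open scoped Kronecker

theorem norm_kronForm_le_of_events {ι σ : Type*} [Fintype ι] [DecidableEq ι] [Fintype σ]
    {δ η t : ℝ} (hδ : 0 < δ) (hη : 0 ≤ η) (hση : Fintype.card σ ≤ η)
    {N N' : Finset (Matrix ι ι ℂ)} (hN : IsUnitBallNet (truncMap ι δ) N)
    (hN' : IsUnitBallNet (vecMap ι) N') {M : Finset (EuclideanSpace ℂ ι)}
    (hM : IsUnitBallNet (LinearMap.id : EuclideanSpace ℂ ι →ₗ[ℝ] _) M)
    {z : EuclideanSpace ℂ ((ι × ι) × σ)}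
    (h1 : z ∉ ⋃ Z ∈ N, ⋃ W ∈ N', kronEvent σ t Z W)
    (h2 : z ∉ ⋃ Z ∈ N', ⋃ W ∈ N, kronEvent σ t Z W)
    (h3 : z ∉ ⋃ u ∈ M, ⋃ v ∈ M, rankOneEvent σ η u v)
    {X Y : Matrix ι ι ℂ} (hX : X.IsHermitian) (hY : Y.IsHermitian) (hX1 : hsSq X ≤ 1)
    (hY1 : hsSq Y ≤ 1) :
    ‖kronForm (coeffMatrix z * (coeffMatrix z)ᴴ) (Fintype.card σ) X Y‖ ≤
      δ⁻¹ * δ⁻¹ * (8 * η) + 2 * (2 * t) := by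
  simp only [Set.mem_iUnion, not_exists] at h1 h2 h3
  have hσ0 : (0 : ℝ) ≤ Fintype.card σ := Nat.cast_nonneg _
  refine norm_kronForm_le_of_split hδ (fun u v hu hv => ?_) (by positivity)
    (fun X Y hX hY hX1 hY1 h => ?_) hX hY hX1 hY1
  · refine norm_kronForm_symRankOne_le _ hσ0 (by linarith) hu hv ?_
    -- The vector `Gᴴ (u ⊗ v)` is bilinear, unlike its squared norm. Net values at most `√(2η)` give
    -- `2 √(2η)` on the ball, hence `8 η` after squaring.
    have hb := hM.norm_bilinear_le Function.injective_id Function.injective_id hM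
      (adjointOnTensor (coeffMatrix z)) (t := √(2 * η)) (fun c hc d hd => ?_) hu hv
    · calc ‖adjointOnTensor (coeffMatrix z) u v‖ ^ 2 ≤ (2 * √(2 * η)) ^ 2 := by gcongr
        _ = 8 * η := by
          rw [mul_pow, Real.sq_sqrt (by positivity)]
          ring
    · refine Real.le_sqrt_of_sq_le ?_
      have hc' : ‖c‖ ≤ 1 := hM.1 c hc
      have hd' : ‖d‖ ≤ 1 := hM.1 d hd
      have := norm_adjointOnTensor_sq_le_of_notMem hc' hd' (h3 c hc d hd)
      linarith
  · have e : kronForm (coeffMatrix z * (coeffMatrix z)ᴴ) (Fintype.card σ) X Y =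
        hermForm (coeffMatrix z * (coeffMatrix z)ᴴ) (Fintype.card σ) X Y := by
      rw [hermForm_apply, hX.hermPart_eq, hY.hermPart_eq]
    rw [e]
    rcases h with h | h
    · exact hN.norm_bilinear_le (truncMap_injective δ) (vecMap_injective ι) hN' (hermForm _ _)
        (fun c hc d hd => norm_hermForm_le_of_notMem (h1 c hc d hd))
        ((norm_truncMap_le_one_iff hδ X).2 ⟨hX1, h⟩) ((norm_vecMap_le_one_iff Y).2 hY1)
    · exact hN'.norm_bilinear_le (vecMap_injective ι) (truncMap_injective δ) hN (hermForm _ _)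
        (fun c hc d hd => norm_hermForm_le_of_notMem (h2 c hc d hd))
        ((norm_vecMap_le_one_iff X).2 hX1) ((norm_truncMap_le_one_iff hδ Y).2 ⟨hY1, h⟩)

theorem isClosed_opBound {m n X : Type*} [Fintype m] [Fintype n] [TopologicalSpace X] {κ : ℝ}
    {f : X → Matrix m n ℂ} (hf : Continuous f) : IsClosed {x | OpBound (f x) κ} := by
  simp only [OpBound, Set.ofPred_forall]
  refine isClosed_iInter fun x => isClosed_iInter fun y => isClosed_le ?_ continuous_const
  fun_prop

/-- With `τ = 6400 = 1/(2δ)` and `t = d² / 320`, `τ t = 20 d²` exceeds the net cost `9 d²` and the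
variance term (below `d²`) by `10 d²`. The choice `η = δ² / 1280` makes the product-vector term `8 η
d² / δ² = d² / 160`; with `4 t = d² / 80` the total stays below the allowed `d² / 40`. -/
theorem entangled_probability (d s : ℕ) (hd : 1 ≤ d) (hs : 1 ≤ s) {δ η : ℝ} (hδ : δ = 1 / 12800)
    (hη : η = δ ^ 2 / 1280) (hsd : (s : ℝ) ≤ η * (d : ℝ) ^ 2) :
    1 - (4 * Real.exp (-(10 * (d : ℝ) ^ 2)) + 2 * Real.exp (9 * d - η / 4 * (d : ℝ) ^ 2) +
      2 * Real.exp (-((d : ℝ) ^ 2 / 16))) ≤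
      (inducedState (Fin d × Fin d) (Fin s)).real {ρ | 1 < traceNorm (realign ρ)} := by
  have hd1 : (1 : ℝ) ≤ d := by exact_mod_cast hd
  have hs1 : (1 : ℝ) ≤ s := by exact_mod_cast hs
  have hδ0 : 0 < δ := by rw [hδ]; norm_num
  have hη0 : 0 < η := by rw [hη]; positivity
  have hη' : η * 209715200000 = 1 := by rw [hη, hδ]; norm_num
  have hd2 : (1 : ℝ) ≤ (d : ℝ) ^ 2 := one_le_pow₀ hd1
  have : NeZero d := ⟨by omega⟩
  have : NeZero s := ⟨by omega⟩
  obtain ⟨N, hN⟩ := exists_isUnitBallNet (truncMap (Fin d) δ) (truncMap_injective δ)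
  obtain ⟨N', hN'⟩ := exists_isUnitBallNet (vecMap (Fin d)) (vecMap_injective _)
  obtain ⟨M, hM⟩ := exists_isUnitBallNet (LinearMap.id : EuclideanSpace ℂ (Fin d) →ₗ[ℝ] _)
    Function.injective_id
  have hfin : Module.finrank ℝ (Matrix (Fin d) (Fin d) ℂ) = 2 * d ^ 2 := by
    rw [Module.finrank_matrix, Complex.finrank_real_complex, Fintype.card_fin]
    ring
  have cN : N.card ≤ 9 ^ (2 * d ^ 2) := hfin ▸ hN.2.1
  have cN' : N'.card ≤ 9 ^ (2 * d ^ 2) := hfin ▸ hN'.2.1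
  have cM : M.card ≤ 9 ^ (2 * d) := by
    have := hM.2.1
    rwa [finrank_real_euclideanSpace_complex, Fintype.card_fin] at this
  set t : ℝ := (d : ℝ) ^ 2 / 320 with ht
  set γ := gaussianOn (EuclideanSpace ℂ ((Fin d × Fin d) × Fin s))
  have hτδ : 6400 * δ ≤ 1 / 2 := by rw [hδ]; norm_num
  have net : ∀ k : ℕ, (9 : ℝ) ^ (2 * k + 2 * k) ≤ Real.exp (9 * k) := by
    intro k
    rw [show 2 * k + 2 * k = 4 * k by ring]
    exact nine_pow_le_exp k
  have hp : (9 : ℝ) ^ (2 * d ^ 2 + 2 * d ^ 2) *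
      (2 * Real.exp (-(6400 * t) + 6400 ^ 2 * Fintype.card (Fin s))) ≤
        2 * Real.exp (-(10 * (d : ℝ) ^ 2)) := by
    have h1 : -(6400 * t) + 6400 ^ 2 * Fintype.card (Fin s) ≤ -(19 * (d : ℝ) ^ 2) := by
      rw [Fintype.card_fin, ht]
      nlinarith
    calc _ ≤ Real.exp (9 * (d ^ 2 : ℕ)) * (2 * Real.exp (-(19 * (d : ℝ) ^ 2))) := by
          gcongr
          exact net _
      _ = _ := by
          rw [mul_left_comm, ← Real.exp_add]
          push_cast
          ring_nf
  have b1 : γ (⋃ Z ∈ N, ⋃ W ∈ N', kronEvent (Fin s) t Z W) ≤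
      ENNReal.ofReal (2 * Real.exp (-(10 * (d : ℝ) ^ 2))) :=
    (measure_iUnion_net_le (by positivity) cN cN' fun Z hZ W hW =>
      gaussianOn_kronEvent_le (by norm_num) hτδ
        ((norm_truncMap_le_one_iff hδ0 Z).1 (hN.1 Z hZ)).1
        ((norm_vecMap_le_one_iff W).1 (hN'.1 W hW))
        (Or.inl ((norm_truncMap_le_one_iff hδ0 Z).1 (hN.1 Z hZ)).2) t).trans
          (ENNReal.ofReal_le_ofReal hp)
  have b2 : γ (⋃ Z ∈ N', ⋃ W ∈ N, kronEvent (Fin s) t Z W) ≤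
      ENNReal.ofReal (2 * Real.exp (-(10 * (d : ℝ) ^ 2))) :=
    (measure_iUnion_net_le (by positivity) cN' cN fun Z hZ W hW =>
      gaussianOn_kronEvent_le (by norm_num) hτδ
        ((norm_vecMap_le_one_iff Z).1 (hN'.1 Z hZ))
        ((norm_truncMap_le_one_iff hδ0 W).1 (hN.1 W hW)).1
        (Or.inr ((norm_truncMap_le_one_iff hδ0 W).1 (hN.1 W hW)).2) t).trans
          (ENNReal.ofReal_le_ofReal hp)
  have b3 : γ (⋃ u ∈ M, ⋃ v ∈ M, rankOneEvent (Fin s) (η * (d : ℝ) ^ 2) u v) ≤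
      ENNReal.ofReal (2 * Real.exp (9 * d - η / 4 * (d : ℝ) ^ 2)) := by
    refine (measure_iUnion_net_le (by positivity) cM cM fun u hu v hv =>
      gaussianOn_rankOneEvent_le (hM.1 u hu) (hM.1 v hv) _).trans (ENNReal.ofReal_le_ofReal ?_)
    have h1 : -(1 / 2 * (η * (d : ℝ) ^ 2)) + (1 / 2) ^ 2 * Fintype.card (Fin s) ≤
        -(η / 4 * (d : ℝ) ^ 2) := by
      rw [Fintype.card_fin]
      linarith
    calc _ ≤ Real.exp (9 * d) * (2 * Real.exp (-(η / 4 * (d : ℝ) ^ 2))) := by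
          gcongr
          exact net _
      _ = _ := by
          rw [mul_left_comm, ← Real.exp_add]
          ring_nf
  have b4 : γ (smallNormEvent (Fin d × Fin d) (Fin s)) ≤
      ENNReal.ofReal (2 * Real.exp (-((d : ℝ) ^ 2 / 16))) := by
    refine (gaussianOn_smallNormEvent_le _ _).trans (ENNReal.ofReal_le_ofReal ?_)
    gcongr
    rw [Fintype.card_prod, Fintype.card_fin, Fintype.card_fin]
    push_cast
    nlinarith
  have hbad := (measure_union_le (μ := γ) _ _).trans (add_le_add
    ((measure_union_le _ _).trans (add_le_add ((measure_union_le _ _).trans (add_le_add b1 b2)) b3))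
    b4)
  rw [← ENNReal.ofReal_add (by positivity) (by positivity),
    ← ENNReal.ofReal_add (by positivity) (by positivity),
    ← ENNReal.ofReal_add (by positivity) (by positivity)] at hbad
  let C : Matrix (Fin d × Fin d) (Fin d × Fin d) ℂ → Matrix (Fin d × Fin d) (Fin d × Fin d) ℂ :=
    fun ρ => ρ - ((Fintype.card (Fin d) : ℂ) ^ 2)⁻¹ • 1
  have hC : Continuous C := by fun_prop
  have hrC : Continuous fun ρ => realign (C ρ) :=
    continuous_matrix fun p q => hC.matrix_elem (p.1, q.1) (p.2, q.2)
  have hD : IsClosed {ρ | 2 * (1 / (4 * (Fintype.card (Fin s) : ℝ))) ≤ (ρᴴ * C ρ).trace.re ∧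
      OpBound (realign (C ρ)) (1 / (4 * (Fintype.card (Fin s) : ℝ)))} :=
    (isClosed_le continuous_const (Complex.continuous_re.comp
      (continuous_id.matrix_conjTranspose.matrix_mul hC).matrix_trace)).inter
        (isClosed_opBound hrC)
  refine le_trans (le_of_eq ?_) (inducedState_real_ge hD.measurableSet (fun ρ hρ => ?_)
    (by positivity) hbad ?_)
  · ring
  · refine one_lt_traceNorm_realign ?_ hρ.1 hρ.2
    rw [Fintype.card_fin]
    positivity
  · intro ψ hψ r hr hgood
    simp only [Set.mem_union, not_or] at hgood
    obtain ⟨⟨⟨g1, g2⟩, g3⟩, g4⟩ := hgood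
    have htr1 : (coeffMatrix ψ * (coeffMatrix ψ)ᴴ).trace = 1 := by
      rw [trace_mul_conjTranspose_eq_norm_sq, hψ]
      simp
    have hnorm : ‖r • ψ‖ ^ 2 = r ^ 2 := by
      rw [norm_smul, hψ, mul_one, Real.norm_eq_abs, sq_abs]
    have hT := fun X Y hX hY hX1 hY1 => norm_kronForm_le_of_events (σ := Fin s) hδ0
      (η := η * (d : ℝ) ^ 2) (by positivity) (by rwa [Fintype.card_fin]) hN hN' hM g1 g2 g3
      (X := X) (Y := Y) hX hY hX1 hY1
    refine ⟨two_mul_le_re_trace _ htr1 ?_, ?_⟩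
    · rw [Fintype.card_fin, Fintype.card_fin]
      nlinarith
    · have hop := opBound_realign (N := r ^ 2) (s := Fintype.card (Fin s)) (by simp; omega)
        (by rw [trace_mul_conjTranspose_eq_norm_sq, hnorm]) ?_ hT ?_
      · rw [gram_smul, smul_smul, ← Complex.ofReal_inv, ← Complex.ofReal_mul,
          inv_mul_cancel₀ (by positivity), Complex.ofReal_one, one_smul] at hop
        exact hop
      · rw [smallNormEvent, Set.mem_ofPred_eq, not_le, hnorm, Fintype.card_prod] at g4
        push_cast at g4
        rw [sq (Fintype.card (Fin d) : ℝ)]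
        exact g4.le
      · rw [Fintype.card_fin, ht, hη, hδ]
        nlinarith

theorem exp_neg_le_exp_neg_rpow {d : ℕ} (hd : 1 ≤ d) :
    Real.exp (-(d : ℝ)) ≤ Real.exp (-1 * (d : ℝ) ^ (1 / 4 : ℝ)) := by
  have hd1 : (1 : ℝ) ≤ d := by exact_mod_cast hd
  have h := Real.rpow_le_rpow_of_exponent_le hd1 (show (1 / 4 : ℝ) ≤ 1 by norm_num)
  rw [Real.rpow_one] at h
  rw [Real.exp_le_exp]
  linarith

end Main

theorem mainTheorem3 :
    ∃ c C c₀ C₀ : ℝ, 0 < c ∧ 0 < C ∧ 0 < c₀ ∧ 0 < C₀ ∧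
      ∀ d s : ℕ, 1 ≤ d → 1 ≤ s →
        ((s : ℝ) ≤ c₀ * (d : ℝ) ^ 2 →
          1 - C * Real.exp (-c * (d : ℝ) ^ (1 / 4 : ℝ)) ≤
            (inducedState (Fin d × Fin d) (Fin s)).real {ρ | 1 < traceNorm (realign ρ)}) ∧
        (C₀ * (d : ℝ) ^ 2 ≤ (s : ℝ) →
          1 - C * Real.exp (-c * (d : ℝ) ^ (1 / 4 : ℝ)) ≤
            (inducedState (Fin d × Fin d) (Fin s)).real {ρ | traceNorm (realign ρ) ≤ 1}) := by
  obtain ⟨η, hη⟩ : ∃ η : ℝ, η = (1 / 12800 : ℝ) ^ 2 / 1280 := ⟨_, rfl⟩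
  have hη0 : 0 < η := by rw [hη]; norm_num
  refine ⟨1, 4 + 2 * Real.exp (100 / η) + 2 * Real.exp 4, η, 4000, one_pos, by positivity, hη0,
    by norm_num, fun d s hd hs => ⟨fun hsd => ?_, fun hsd => ?_⟩⟩
  · have hd1 : (1 : ℝ) ≤ d := by exact_mod_cast hd
    refine le_trans ?_ (entangled_probability d s hd hs rfl hη hsd)
    have h0 := exp_neg_le_exp_neg_rpow hd
    have h1 : Real.exp (-(10 * (d : ℝ) ^ 2)) ≤ Real.exp (-(d : ℝ)) := by
      rw [Real.exp_le_exp]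
      nlinarith
    have h2 : Real.exp (9 * d - η / 4 * (d : ℝ) ^ 2) ≤
        Real.exp (100 / η) * Real.exp (-(d : ℝ)) := by
      rw [← Real.exp_add, Real.exp_le_exp]
      -- Completing the square gives `9 d - η d² / 4 ≤ 100 / η - d`, the source of `exp (100 / η)`
      -- in `C`.
      have h3 : 0 ≤ (η * d / 2 - 10) ^ 2 / η := by positivity
      have h4 : (η * d / 2 - 10) ^ 2 / η = η / 4 * (d : ℝ) ^ 2 - 10 * d + 100 / η := by
        field_simp
        ring
      linarith
    have h3 : Real.exp (-((d : ℝ) ^ 2 / 16)) ≤ Real.exp 4 * Real.exp (-(d : ℝ)) := by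
      rw [← Real.exp_add, Real.exp_le_exp]
      nlinarith [sq_nonneg ((d : ℝ) - 8)]
    have h4 : (4 + 2 * Real.exp (100 / η) + 2 * Real.exp 4) * Real.exp (-(d : ℝ)) ≤
        (4 + 2 * Real.exp (100 / η) + 2 * Real.exp 4) *
          Real.exp (-1 * (d : ℝ) ^ (1 / 4 : ℝ)) := by gcongr
    linarith
  · have h0 := exp_neg_le_exp_neg_rpow hd
    rcases Nat.lt_or_ge d 2 with h | h
    · have hd1 : d = 1 := by omega
      subst hd1
      -- For `d = 1` the constant already makes the lower bound nonpositive.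
      have h1 : (1 : ℝ) ≤ Real.exp 4 * Real.exp (-1) := by
        rw [← Real.exp_add]
        exact Real.one_le_exp (by norm_num)
      have h2 : (0 : ℝ) ≤ (4 + 2 * Real.exp (100 / η) + Real.exp 4) * Real.exp (-1) := by
        positivity
      refine le_trans ?_ measureReal_nonneg
      norm_num
      linarith
    · refine le_trans ?_ (separable_probability d s h hsd)
      have hd1 : (1 : ℝ) ≤ d := by exact_mod_cast hd
      have h1 : Real.exp (-(d : ℝ) ^ 2) ≤ Real.exp (-(d : ℝ)) := by
        rw [Real.exp_le_exp]
        nlinarith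
      have h2 : 2 * Real.exp (-1 * (d : ℝ) ^ (1 / 4 : ℝ)) ≤
          (4 + 2 * Real.exp (100 / η) + 2 * Real.exp 4) *
            Real.exp (-1 * (d : ℝ) ^ (1 / 4 : ℝ)) := by
        gcongr
        linarith [Real.exp_pos (100 / η), Real.exp_pos 4]
      linarith
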